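/- Let $k$ be an algebraically closed field of characteristic $0$ and let $k\langle x_1,\dots,x_g\rangle$ be the free $k$-algebra. For $n\ge 1$ let $X^{(n)}=(X^{(n)}_1,\dots,X^{(n)}_g)$ be a tuple of generic $n\times n$ matrices, i.e. the $gn^2$ entries of these matrices are independent commuting variables. A nonconstant $f\in k\langle x_1,\dots,x_g\rangle$ is called an atom if it is not a product of two nonconstant elements of $k\langle x_1,\dots,x_g\rangle$. A matrix in $M_d(k\langle x_1,\dots,x_g\rangle)$ is called an atom if it is not a zero divisor, is not invertible, and is not a product of two non-invertible matrices in $M_d(k\langle x_1,\dots,x_g\rangle)$. A monic pencil of size $d$ is a matrix $L=I_d-\sum_{j=1}^g A_jx_j$ with $A_1,\dots,A_g\in M_d(k)$, and $L(X^{(n)})=I_{dn}-\sum_{j=1}^g A_j\otimes X^{(n)}_j$. For integers $\delta>1$ and $d>1$ set $$n_1(\delta)=\left\lceil \frac{\delta}{2}\right\rceil,\qquad n_2(d)=\begin{cases}1 & d=2,\\ \left\lceil (d-1)\sqrt{\frac{2(d-1)^2}{d-2}+\frac14}+\frac{d-1}{2}-2\right\rceil & d\ge 3.\end{cases}$$ (1)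 Let $f\in k\langle x_1,\dots,x_g\rangle$ have degree $\delta>1$ and $f(0)=1$. If $\det f(X^{(n)})$ is an irreducible polynomial for some $n\ge n_1(\delta)$, then $f$ is an atom. (2) Let $L$ be a monic pencil of size $d>1$. If $\det L(X^{(n)})$ is an irreducible polynomial for some $n\ge n_2(d)$, then $L$ is an atom in $M_d(k\langle x_1,\dots,x_g\rangle)$. -/

import Mathlib

open scoped Kronecker

noncomputable section

namespace FreeLocus

/-- The total degree of a noncommutative polynomial: the largest length of a word that occurs in it
with nonzero coefficient (`0` for the zero polynomial). -/
def ncDegree {k : Type*} [Field k] {g : ℕ} (f : FreeAlgebra k (Fin g)) : ℕ :=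
  (FreeAlgebra.equivMonoidAlgebraFreeMonoid f).coeff.support.sup FreeMonoid.length

/-- A noncommutative polynomial is constant if it is a scalar multiple of `1`. -/
def IsConstant {k : Type*} [Field k] {g : ℕ} (f : FreeAlgebra k (Fin g)) : Prop :=
  ∃ c : k, f = algebraMap k (FreeAlgebra k (Fin g)) c

/-- An atom of the free algebra: a nonconstant noncommutative polynomial that is not a product of
two nonconstant ones. -/
def IsPolyAtom {k : Type*} [Field k] {g : ℕ} (f : FreeAlgebra k (Fin g)) : Prop :=
  ¬ IsConstant f ∧
    ¬ ∃ f₁ f₂ : FreeAlgebra k (Fin g), ¬ IsConstant f₁ ∧ ¬ IsConstant f₂ ∧ f = f₁ * f₂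

/-- An atom of the ring of `d × d` matrices over the free algebra: a regular (not a left or right
zero divisor) non-invertible matrix that is not a product of two non-invertible matrices. -/
def IsMatrixAtom {k : Type*} [Field k] {g d : ℕ}
    (f : Matrix (Fin d) (Fin d) (FreeAlgebra k (Fin g))) : Prop :=
  IsRegular f ∧ ¬ IsUnit f ∧
    ¬ ∃ f₁ f₂ : Matrix (Fin d) (Fin d) (FreeAlgebra k (Fin g)),
      ¬ IsUnit f₁ ∧ ¬ IsUnit f₂ ∧ f = f₁ * f₂

/-- The `j`-th generic `n × n` matrix, whose entries are independent commuting variables. -/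
def genericMatrix (k : Type*) [Field k] (g n : ℕ) (j : Fin g) :
    Matrix (Fin n) (Fin n) (MvPolynomial (Fin g × Fin n × Fin n) k) :=
  Matrix.of fun r s => MvPolynomial.X (j, r, s)

/-- The evaluation of a noncommutative polynomial at the tuple of generic `n × n` matrices. -/
def polyEval {k : Type*} [Field k] {g : ℕ} (f : FreeAlgebra k (Fin g)) (n : ℕ) :
    Matrix (Fin n) (Fin n) (MvPolynomial (Fin g × Fin n × Fin n) k) :=
  FreeAlgebra.lift k (genericMatrix k g n) f

/-- The monic linear pencil `I - ∑ A_j x_j` as a matrix over the free algebra. -/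
def monicPencil {k : Type*} [Field k] {g d : ℕ} (A : Fin g → Matrix (Fin d) (Fin d) k) :
    Matrix (Fin d) (Fin d) (FreeAlgebra k (Fin g)) :=
  1 - ∑ j, (A j).map fun a => a • FreeAlgebra.ι k j

/-- The evaluation `I - ∑ A_j ⊗ X_j` of the monic pencil with coefficients `A` at the tuple of
generic `n × n` matrices. -/
def pencilEval {k : Type*} [Field k] {g d : ℕ} (A : Fin g → Matrix (Fin d) (Fin d) k) (n : ℕ) :
    Matrix (Fin d × Fin n) (Fin d × Fin n) (MvPolynomial (Fin g × Fin n × Fin n) k) :=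
  1 - ∑ j, (A j).map (fun a => MvPolynomial.C a) ⊗ₖ genericMatrix k g n j

/-- Evaluating the entries of the pencil over the free algebra gives the blocks of its Kronecker
product evaluation. -/
theorem pencilEval_apply {k : Type*} [Field k] {g d : ℕ} (A : Fin g → Matrix (Fin d) (Fin d) k)
    (n : ℕ) (p q : Fin d) (r s : Fin n) :
    pencilEval A n (p, r) (q, s) = polyEval (monicPencil A p q) n r s := by
  have h1 : FreeAlgebra.lift k (genericMatrix k g n) ((1 : Matrix (Fin d) (Fin d) _) p q) r s
      = (1 : Matrix (Fin d × Fin n) (Fin d × Fin n) (MvPolynomial (Fin g × Fin n × Fin n) k))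
        (p, r) (q, s) := by
    by_cases h : p = q
    · subst h
      by_cases h' : r = s <;> simp [Matrix.one_apply, h']
    · simp [Matrix.one_apply, h]
  simp [pencilEval, polyEval, monicPencil, Matrix.sub_apply, Matrix.sum_apply, h1,
    Matrix.kroneckerMap_apply, MvPolynomial.smul_eq_C_mul]

/-- The bound `⌈δ / 2⌉`. -/
def n₁ (δ : ℕ) : ℕ := ⌈(δ : ℝ) / 2⌉₊

/-- The bound for pencils of size `d ≥ 2`; for `d ≥ 3` the real number under the ceiling is
positive, so the natural-number ceiling is the usual one. -/
def n₂ (d : ℕ) : ℕ :=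
  if d = 2 then 1
  else ⌈((d : ℝ) - 1) * Real.sqrt (2 * ((d : ℝ) - 1) ^ 2 / ((d : ℝ) - 2) + 1 / 4)
    + ((d : ℝ) - 1) / 2 - 2⌉₊

end FreeLocus

end


/-!
Suppose that the determinant of a product, evaluated at generic `n × n` matrices, is irreducible.
Then the determinant of one of the two factors is a unit, hence remains a unit at every tuple of
`n × n` matrices.

*Polynomials.* Evaluate the factor at weighted adjacency matrices of an oriented cycle with loops.
The rotational symmetry of the cycle forces the value to be diagonal with constant entries. Cut the
cycle open to a path: its `n` loops and `n - 1` edges can be passed one after the other, each once,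
so the coefficients of all words of length less than `2 n` can be read off from walks along the
path. If the product has degree at most `2 n`, then the words of the nonconstant factors are that
short, and the factor with unit determinant is constant.

*Pencils.* Let `L = F G` and let `W` be the space of constant vectors in the column space of `F`.
Division by `L` with remainder shows that `v ∈ W` if and only if `A_j v ∈ W` for all `j`. So `W` is
invariant, and `det L` is the product of the determinants of the pencils of the restrictions and of
the quotients of the `A_j`. If the one with unit determinant has size `p`, with `2 p ≤ n + 2`, then
its coefficients are jointly nilpotent: otherwise evaluate at the weighted cyclic shift, where the
unit determinant makes the product of `n` generic linear combinations of the coefficients nilpotent;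
the ranks of such products depend only on the number of factors and are stationary from `p - 1`
factors on, which excludes nilpotency. By the above equivalence, joint nilpotency on the quotient
gives `W = k^d` and hence that `F` is invertible; joint nilpotency on `W` gives that the columns of
`F` lie in the column space of `L`, so that `G` is invertible.
-/

noncomputable section

namespace FreeLocus

open scoped Matrix Polynomial

section WordCoeff

variable {R X : Type*} [CommSemiring R]

/-- The coefficient of the word `w` in a noncommutative polynomial. -/
def wordCoeff (w : FreeMonoid X) : FreeAlgebra R X →ₗ[R] R :=
  (FreeAlgebra.basisFreeMonoid R X).coord w

theorem wordCoeff_eq_coeff (w : FreeMonoid X) (f : FreeAlgebra R X) :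
    wordCoeff w f = (FreeAlgebra.equivMonoidAlgebraFreeMonoid f).coeff w :=
  rfl

theorem ext_wordCoeff {f f' : FreeAlgebra R X} (h : ∀ w, wordCoeff w f = wordCoeff w f') :
    f = f' :=
  (FreeAlgebra.basisFreeMonoid R X).ext_elem h

theorem reverse_word_induction {P : FreeMonoid X → Prop} (one : P 1)
    (mul_of : ∀ w j, P w → P (w * FreeMonoid.of j)) (w : FreeMonoid X) : P w :=
  List.reverseRecOn w one mul_of

theorem lift_basisFreeMonoid {S : Type*} [Semiring S] [Algebra R S] (F : X → S)
    (w : FreeMonoid X) :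
    FreeAlgebra.lift R F (FreeAlgebra.basisFreeMonoid R X w) = FreeMonoid.lift F w := by
  have hw : FreeAlgebra.basisFreeMonoid R X w = FreeMonoid.lift (FreeAlgebra.ι R) w := by
    simp [FreeAlgebra.basisFreeMonoid, FreeAlgebra.equivMonoidAlgebraFreeMonoid]
  rw [hw, ← AlgHom.coe_toMonoidHom, ← MonoidHom.comp_apply]
  congr 1
  ext
  simp

theorem wordCoeff_one (f : FreeAlgebra R X) : wordCoeff 1 f = FreeAlgebra.algebraMapInv f := by
  suffices wordCoeff 1 = (FreeAlgebra.algebraMapInv : FreeAlgebra R X →ₐ[R] R).toLinearMap from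
    LinearMap.congr_fun this f
  refine (FreeAlgebra.basisFreeMonoid R X).ext fun w => ?_
  rw [AlgHom.toLinearMap_apply, FreeAlgebra.algebraMapInv, lift_basisFreeMonoid]
  induction w using reverse_word_induction <;> simp [wordCoeff]

theorem wordCoeff_algebraMap {w : FreeMonoid X} (hw : w ≠ 1) (c : R) :
    wordCoeff w (algebraMap R (FreeAlgebra R X) c) = 0 := by
  simp [wordCoeff_eq_coeff, hw.symm]

theorem wordCoeff_mul_of_mul_ι (w : FreeMonoid X) (f : FreeAlgebra R X) (j : X) :
    wordCoeff (w * FreeMonoid.of j) (f * FreeAlgebra.ι R j) = wordCoeff w f := by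
  simp [wordCoeff_eq_coeff, FreeAlgebra.equivMonoidAlgebraFreeMonoid,
    MonoidAlgebra.coeff_mul_single_mul]

theorem wordCoeff_mul_ι_of_forall_ne {w : FreeMonoid X} {j : X}
    (hw : ∀ v, v * FreeMonoid.of j ≠ w) (f : FreeAlgebra R X) :
    wordCoeff w (f * FreeAlgebra.ι R j) = 0 := by
  simp [wordCoeff_eq_coeff, FreeAlgebra.equivMonoidAlgebraFreeMonoid,
    MonoidAlgebra.coeff_mul_single_of_forall_mul_ne _ _ hw]

end WordCoeff

section Degree

variable {k : Type*} [Field k] {g : ℕ}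

theorem isConstant_of_wordCoeff_eq_zero {f : FreeAlgebra k (Fin g)}
    (h : ∀ w ≠ 1, wordCoeff w f = 0) : IsConstant f := by
  refine ⟨wordCoeff 1 f, ext_wordCoeff fun w => ?_⟩
  by_cases hw : w = 1
  · subst hw
    simp [wordCoeff_one, FreeAlgebra.algebraMapInv]
  · rw [h w hw, wordCoeff_algebraMap hw]

theorem wordCoeff_eq_zero_of_ncDegree_lt {f : FreeAlgebra k (Fin g)} {w : FreeMonoid (Fin g)}
    (h : ncDegree f < w.length) : wordCoeff w f = 0 := by
  by_contra hw
  exact h.not_ge (Finset.le_sup (f := FreeMonoid.length) (Finsupp.mem_support_iff.mpr hw))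

theorem isConstant_of_ncDegree_eq_zero {f : FreeAlgebra k (Fin g)} (h : ncDegree f = 0) :
    IsConstant f :=
  isConstant_of_wordCoeff_eq_zero fun w hw => wordCoeff_eq_zero_of_ncDegree_lt <| by
    rwa [h, Nat.pos_iff_ne_zero, ne_eq, FreeMonoid.length_eq_zero]

theorem exists_length_eq_ncDegree {f : FreeAlgebra k (Fin g)} (h : f ≠ 0) :
    ∃ w, wordCoeff w f ≠ 0 ∧ w.length = ncDegree f := by
  have hne : (FreeAlgebra.equivMonoidAlgebraFreeMonoid f).coeff.support.Nonempty := by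
    rw [Finsupp.support_nonempty_iff]
    simpa using h
  obtain ⟨w, hw, hsup⟩ := Finset.exists_mem_eq_sup _ hne FreeMonoid.length
  exact ⟨w, Finsupp.mem_support_iff.mp hw, hsup.symm⟩

theorem ncDegree_add_le_ncDegree_mul {f₁ f₂ : FreeAlgebra k (Fin g)} (h₁ : f₁ ≠ 0) (h₂ : f₂ ≠ 0) :
    ncDegree f₁ + ncDegree f₂ ≤ ncDegree (f₁ * f₂) := by
  obtain ⟨v₁, hv₁, hl₁⟩ := exists_length_eq_ncDegree h₁
  obtain ⟨v₂, hv₂, hl₂⟩ := exists_length_eq_ncDegree h₂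
  have huniq : UniqueMul (FreeAlgebra.equivMonoidAlgebraFreeMonoid f₁).coeff.support
      (FreeAlgebra.equivMonoidAlgebraFreeMonoid f₂).coeff.support v₁ v₂ := by
    intro a b ha hb hab
    have la : a.length ≤ ncDegree f₁ := Finset.le_sup (f := FreeMonoid.length) ha
    have lb : b.length ≤ ncDegree f₂ := Finset.le_sup (f := FreeMonoid.length) hb
    have hlen := congrArg FreeMonoid.length hab
    rw [FreeMonoid.length_mul, FreeMonoid.length_mul] at hlen
    exact List.append_inj hab (show a.length = v₁.length by omega)
  rw [← hl₁, ← hl₂, ← FreeMonoid.length_mul]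
  by_contra! hlt
  have hzero := wordCoeff_eq_zero_of_ncDegree_lt hlt
  rw [wordCoeff_eq_coeff, map_mul FreeAlgebra.equivMonoidAlgebraFreeMonoid,
    MonoidAlgebra.coeff_mul_mul_of_uniqueMul huniq] at hzero
  exact mul_ne_zero hv₁ hv₂ hzero

end Degree

section CyclicGrading

variable {R : Type*} [CommRing R] {n : ℕ}

theorem coeff_det_of_natDegree_le {ι : Type*} [Fintype ι] [DecidableEq ι]
    (M : Matrix ι ι R[X]) {m : ℕ} (h : ∀ i i', (M i i').natDegree ≤ m) :
    M.det.coeff (Fintype.card ι * m) = (M.map fun p => p.coeff m).det := by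
  simp only [Matrix.det_apply, Polynomial.finsetSum_coeff, Polynomial.coeff_smul]
  refine Finset.sum_congr rfl fun τ _ => congrArg _ ?_
  exact Polynomial.coeff_prod_of_natDegree_le _ _ _ fun i _ => h _ _

/-- The algebra of polynomial matrices with rows and columns in the cycle `ℤ / (n + 1)`, in which
the monomials of degree `m` occur only in the entries `(i, i + m)`. -/
def cyclicallyGraded (k R : Type*) [CommSemiring k] [CommRing R] [Algebra k R] (n : ℕ) :
    Subalgebra k (Matrix (Fin (n + 1)) (Fin (n + 1)) R[X]) where
  carrier := {M | ∀ i i' m, i + Fin.ofNat (n + 1) m ≠ i' → (M i i').coeff m = 0}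
  add_mem' hM hN i i' m h := by simp [hM i i' m h, hN i i' m h]
  mul_mem' {M N} hM hN i i' m h := by
    simp only [Matrix.mul_apply, Polynomial.finsetSum_coeff, Polynomial.coeff_mul]
    refine Finset.sum_eq_zero fun l _ => Finset.sum_eq_zero fun p hp => ?_
    by_cases hl : i + Fin.ofNat (n + 1) p.1 = l
    · rw [hN l i' p.2 fun hl' => h ?_, mul_zero]
      rw [← hl', ← hl, ← Finset.HasAntidiagonal.mem_antidiagonal.mp hp, add_assoc]
      congr 1
      ext
      simp [Fin.val_add]
    · rw [hM i l p.1 hl, zero_mul]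
  algebraMap_mem' c i i' m h := by
    rw [Matrix.algebraMap_matrix_apply]
    split_ifs with hi
    · rw [Polynomial.algebraMap_apply, Polynomial.coeff_C_of_ne_zero]
      rintro rfl
      exact h (by simpa using hi)
    · exact Polynomial.coeff_zero m

theorem exists_forall_coeff_eq_ite {k : Type*} [CommSemiring k] [Algebra k R]
    {σ : Fin (n + 1) → R →+* R} {M : Matrix (Fin (n + 1)) (Fin (n + 1)) R[X]}
    (hM : M ∈ cyclicallyGraded k R n) (hrot : ∀ i i', M i (i' + i) = (M 0 i').map (σ i)) :
    ∃ P : R[X], ∀ i i' m, (M i i').coeff m =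
      if i + Fin.ofNat (n + 1) m = i' then σ i (P.coeff m) else 0 := by
  refine ⟨∑ i', M 0 i', fun i i' m => ?_⟩
  split_ifs with h
  · rw [← h, add_comm, hrot, Polynomial.coeff_map, Polynomial.finsetSum_coeff,
      Finset.sum_eq_single (Fin.ofNat (n + 1) m)
        (fun l _ hl => hM 0 l m (by simpa using hl.symm)) (by simp)]
  · exact hM i i' m h

/-- An invertible determinant excludes positive degrees because the coefficients of top degree form
the product of a diagonal matrix and a permutation matrix. -/
theorem eq_diagonal_of_isUnit_det [IsDomain R] {σ : Fin (n + 1) → R →+* R}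
    (hσ : ∀ i, Function.Injective (σ i)) {M : Matrix (Fin (n + 1)) (Fin (n + 1)) R[X]} {P : R[X]}
    (hM : ∀ i i' m, (M i i').coeff m =
      if i + Fin.ofNat (n + 1) m = i' then σ i (P.coeff m) else 0) (hu : IsUnit M.det) :
    ∃ a : Fin (n + 1) → R, (∀ i, IsUnit (a i)) ∧ M = Matrix.diagonal (Polynomial.C ∘ a) := by
  have hdeg : ∀ i i', (M i i').natDegree ≤ P.natDegree := fun i i' => by
    refine Polynomial.natDegree_le_iff_coeff_eq_zero.mpr fun m hm => ?_
    rw [hM, Polynomial.coeff_eq_zero_of_natDegree_lt hm, map_zero, ite_self]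
  have hlead : (M.map fun p => p.coeff P.natDegree).submatrix id
      (Equiv.addRight (Fin.ofNat (n + 1) P.natDegree)) =
        Matrix.diagonal fun i => σ i P.leadingCoeff := by
    ext i i'
    simp [hM, Matrix.diagonal_apply]
  have hP : P ≠ 0 := by
    rintro rfl
    have hM0 : M = 0 := by
      ext i i' m
      simp [hM]
    simp [hM0] at hu
  have hdet : M.det.coeff ((n + 1) * P.natDegree) ≠ 0 := by
    have hprod : ∏ i, σ i P.leadingCoeff ≠ 0 := Finset.prod_ne_zero_iff.mpr fun i _ =>
      (map_ne_zero_iff _ (hσ i)).mpr (Polynomial.leadingCoeff_ne_zero.mpr hP)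
    rw [← Matrix.det_diagonal, ← hlead, Matrix.det_permute', ← coeff_det_of_natDegree_le M hdeg,
      Fintype.card_fin] at hprod
    exact right_ne_zero_of_mul hprod
  have hP_deg : P.natDegree = 0 := by
    have := Polynomial.le_natDegree_of_ne_zero hdet
    rw [Polynomial.natDegree_eq_zero_of_isUnit hu] at this
    simpa using this
  have hdiag : M = Matrix.diagonal (Polynomial.C ∘ fun i => σ i (P.coeff 0)) := by
    rw [Polynomial.eq_C_of_natDegree_eq_zero hP_deg] at hM
    ext i i' m
    rw [hM, Matrix.diagonal_apply]
    rcases eq_or_ne m 0 with rfl | hm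
    · simp [apply_ite (Polynomial.coeff · 0)]
    · simp [apply_ite (Polynomial.coeff · m), Polynomial.coeff_C, hm]
  refine ⟨_, fun i => ?_, hdiag⟩
  rw [hdiag, Matrix.det_diagonal, IsUnit.prod_univ_iff] at hu
  exact Polynomial.isUnit_C.mp (hu i)

end CyclicGrading

section Cycle

variable {k : Type*} [Field k] {g n : ℕ}

theorem aeval_det_polyEval {S : Type*} [CommRing S] [Algebra k S]
    (Y : Fin g → Matrix (Fin n) (Fin n) S) (f : FreeAlgebra k (Fin g)) :
    MvPolynomial.aeval (fun v : Fin g × Fin n × Fin n => Y v.1 v.2.1 v.2.2) (polyEval f n).det =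
      (FreeAlgebra.lift k Y f).det := by
  suffices (MvPolynomial.aeval (R := k) fun v : Fin g × Fin n × Fin n =>
      Y v.1 v.2.1 v.2.2).mapMatrix.comp (FreeAlgebra.lift k (genericMatrix k g n)) =
        FreeAlgebra.lift k Y by
    rw [AlgHom.map_det, ← this]
    rfl
  ext
  simp [genericMatrix]

theorem lift_mem {X S : Type*} [Semiring S] [Algebra k S] {T : Subalgebra k S} {F : X → S}
    (hF : ∀ j, F j ∈ T) (f : FreeAlgebra k X) : FreeAlgebra.lift k F f ∈ T := by
  refine Algebra.adjoin_le (Set.range_subset_iff.mpr hF) ?_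
  rw [Algebra.adjoin_range_eq_range_freeAlgebra_lift]
  exact ⟨f, rfl⟩

/-- The weighted adjacency matrix of an oriented cycle with a loop at each vertex. The loop and the
edge of the cycle that leave the vertex `i` carry the variables `(j, false, i)` and `(j, true, i)`,
and the edge moreover the polynomial variable. -/
def cycleMatrix (k : Type*) [Field k] (g n : ℕ) (j : Fin g) :
    Matrix (Fin (n + 1)) (Fin (n + 1)) (MvPolynomial (Fin g × Bool × Fin (n + 1)) k)[X] :=
  .of fun i i' =>
    (if i = i' then Polynomial.C (MvPolynomial.X (j, false, i)) else 0) +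
      if i + 1 = i' then Polynomial.C (MvPolynomial.X (j, true, i)) * Polynomial.X else 0

theorem lift_cycleMatrix_mem_cyclicallyGraded (f : FreeAlgebra k (Fin g)) :
    FreeAlgebra.lift k (cycleMatrix k g n) f ∈ cyclicallyGraded k _ n := by
  refine lift_mem (fun j i i' m h => ?_) f
  have hloop : i = i' → m ≠ 0 := by
    rintro rfl rfl
    simp at h
  have hedge : i + 1 = i' → 1 ≠ m := by
    rintro rfl rfl
    exact h rfl
  clear h
  simp only [cycleMatrix, Matrix.of_apply, Polynomial.coeff_add]
  split_ifs with h₀ h₁ h₁ <;>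
    simp_all [Polynomial.coeff_C, Polynomial.coeff_X]

/-- The rotation of the variables of `cycleMatrix` along the cycle. -/
def rotate (k : Type*) [Field k] (g : ℕ) {n : ℕ} (r : Fin (n + 1)) :
    MvPolynomial (Fin g × Bool × Fin (n + 1)) k →ₐ[k]
      MvPolynomial (Fin g × Bool × Fin (n + 1)) k :=
  MvPolynomial.rename fun v => (v.1, v.2.1, v.2.2 + r)

theorem rotate_injective (r : Fin (n + 1)) : Function.Injective (rotate k g r) := by
  refine MvPolynomial.rename_injective _ fun v v' h => ?_
  simpa [Prod.ext_iff] using h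

theorem lift_cycleMatrix_add_right (f : FreeAlgebra k (Fin g)) (r i i' : Fin (n + 1)) :
    FreeAlgebra.lift k (cycleMatrix k g n) f (i + r) (i' + r) =
      (FreeAlgebra.lift k (cycleMatrix k g n) f i i').map (rotate k g r) := by
  suffices (Matrix.reindexAlgEquiv k _ (Equiv.addRight r).symm).toAlgHom.comp
      (FreeAlgebra.lift k (cycleMatrix k g n)) =
        (Polynomial.mapAlgHom (rotate k g r)).mapMatrix.comp
          (FreeAlgebra.lift k (cycleMatrix k g n)) from
    congrFun₂ (DFunLike.congr_fun this f) i i'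
  ext j i i' : 4
  simp [cycleMatrix, rotate, add_right_comm i r, apply_ite (Polynomial.map _)]

theorem exists_lift_cycleMatrix_eq_diagonal {f : FreeAlgebra k (Fin g)}
    (h : IsUnit (polyEval f (n + 1)).det) :
    ∃ c : Fin (n + 1) → k, FreeAlgebra.lift k (cycleMatrix k g n) f =
      Matrix.diagonal fun i => Polynomial.C (MvPolynomial.C (c i)) := by
  have hdet : IsUnit (FreeAlgebra.lift k (cycleMatrix k g n) f).det :=
    aeval_det_polyEval (cycleMatrix k g n) f ▸ h.map (MvPolynomial.aeval _)
  obtain ⟨P, hP⟩ := exists_forall_coeff_eq_ite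
    (σ := fun r : Fin (n + 1) => (rotate k g r).toRingHom)
    (lift_cycleMatrix_mem_cyclicallyGraded f) fun i i' => by
      simpa using lift_cycleMatrix_add_right f i 0 i'
  obtain ⟨a, ha, hdiag⟩ := eq_diagonal_of_isUnit_det rotate_injective hP hdet
  choose c _ hc using fun i => MvPolynomial.isUnit_iff_eq_C_of_isReduced.mp (ha i)
  refine ⟨c, ?_⟩
  rw [hdiag]
  congr 1
  exact funext fun i => congrArg _ (hc i)

/-- The weighted adjacency matrix of an oriented path with a loop at each vertex. Loops and edges
are numbered consecutively along the path: the loop at `s` is number `2 * s` and the edge from `s`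
to `s + 1` is number `2 * s + 1`. -/
def pathMatrix (k : Type*) [Field k] (g n : ℕ) (j : Fin g) :
    Matrix (Fin (n + 1)) (Fin (n + 1)) (MvPolynomial (Fin g × ℕ) k) :=
  .of fun s s' =>
    if s.1 = s' ∨ s.1 + 1 = s' then MvPolynomial.X (j, (s + s' : ℕ)) else 0

/-- Cutting the edge of the cycle that returns to the vertex `0`. -/
def cutCycle (k : Type*) [Field k] (g n : ℕ) :
    (MvPolynomial (Fin g × Bool × Fin (n + 1)) k)[X] →ₐ[k] MvPolynomial (Fin g × ℕ) k :=
  (MvPolynomial.aeval fun v => if v.2.1 = true ∧ v.2.2 = Fin.last n then 0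
    else MvPolynomial.X (v.1, 2 * (v.2.2 : ℕ) + v.2.1.toNat)).comp
    ((Polynomial.aeval (1 : MvPolynomial (Fin g × Bool × Fin (n + 1)) k)).restrictScalars k)

theorem map_cutCycle_cycleMatrix (j : Fin g) :
    (cutCycle k g n).mapMatrix (cycleMatrix k g n j) = pathMatrix k g n j := by
  ext1 s s'
  have hloop : cutCycle k g n (Polynomial.C (MvPolynomial.X (j, false, s))) =
      MvPolynomial.X (j, 2 * (s : ℕ)) := by simp [cutCycle]
  have hedge : cutCycle k g n (Polynomial.C (MvPolynomial.X (j, true, s)) * Polynomial.X) =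
      if s = Fin.last n then 0 else MvPolynomial.X (j, 2 * (s : ℕ) + 1) := by simp [cutCycle]
  simp only [cycleMatrix, pathMatrix, AlgHom.mapMatrix_apply, Matrix.map_apply, Matrix.of_apply,
    map_add, apply_ite (cutCycle k g n), map_zero, hloop, hedge]
  rcases eq_or_ne s (Fin.last n) with rfl | hs
  · have := s'.is_lt
    grind [Fin.ext_iff]
  · have hs1 : ((s + 1 : Fin (n + 1)) : ℕ) = s + 1 :=
      Fin.val_add_one_of_lt (Fin.lt_last_iff_ne_last.mpr hs)
    grind [Fin.ext_iff]

theorem exists_lift_pathMatrix_eq_diagonal {f : FreeAlgebra k (Fin g)}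
    (h : IsUnit (polyEval f (n + 1)).det) :
    ∃ c : Fin (n + 1) → k, FreeAlgebra.lift k (pathMatrix k g n) f =
      Matrix.diagonal fun i => MvPolynomial.C (c i) := by
  obtain ⟨c, hc⟩ := exists_lift_cycleMatrix_eq_diagonal h
  have hcut : (cutCycle k g n).mapMatrix.comp (FreeAlgebra.lift k (cycleMatrix k g n)) =
      FreeAlgebra.lift k (pathMatrix k g n) := by
    ext1
    exact funext fun j => by simpa using map_cutCycle_cycleMatrix j
  refine ⟨c, ?_⟩
  rw [← hcut, AlgHom.comp_apply, hc]
  simp [Matrix.diagonal_map, cutCycle, Function.comp_def]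

end Cycle

section Stair

variable {k : Type*} [Field k] {g n : ℕ}

/-- The exponent of the product of the variables `(v_i, p + i)`, for the letters `v_0, v_1, …` of
`v`: it is the weight, in terms of `pathMatrix`, of a walk spelling `v` that traverses the loops and
edges with the numbers `p, p + 1, …` once each. -/
def stair : ℕ → List (Fin g) → (Fin g × ℕ →₀ ℕ)
  | _, [] => 0
  | p, j :: v => Finsupp.single (j, p) 1 + stair (p + 1) v

theorem stair_apply_of_lt {p q : ℕ} (h : q < p) (v : List (Fin g)) (j : Fin g) :
    stair p v (j, q) = 0 := by
  induction v generalizing p with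
  | nil => rfl
  | cons i v ih => simp [stair, ih (h.trans p.lt_succ_self), h.ne']

theorem stair_cons_ne_zero (p : ℕ) (j : Fin g) (v : List (Fin g)) : stair p (j :: v) ≠ 0 :=
  fun h => by simpa [stair] using DFunLike.congr_fun h (j, p)

theorem coeff_X_mul_eq_zero {R τ : Type*} [CommSemiring R] {e : τ →₀ ℕ} {x : τ} (h : e x = 0)
    (u : MvPolynomial τ R) :
    (MvPolynomial.X x * u).coeff e = 0 := by
  classical
  rw [MvPolynomial.coeff_X_mul', if_neg (Finsupp.notMem_support_iff.mpr h)]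

theorem coeff_X_mul_eq_zero_of_apply_ne_zero {R τ : Type*} [CommSemiring R] {x y : τ}
    {u : MvPolynomial τ R} (hu : ∀ e : τ →₀ ℕ, e y ≠ 0 → u.coeff e = 0) (hxy : x ≠ y)
    {e : τ →₀ ℕ} (he : e y ≠ 0) :
    (MvPolynomial.X x * u).coeff e = 0 := by
  classical
  rw [MvPolynomial.coeff_X_mul', hu _ (by simpa [Finsupp.single_apply, hxy] using he), ite_self]

theorem coeff_stair_cons_X_mul (p : ℕ) (i j : Fin g) (v : List (Fin g))
    (u : MvPolynomial (Fin g × ℕ) k) :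
    (MvPolynomial.X (i, p) * u).coeff (stair p (j :: v)) =
      if i = j then u.coeff (stair (p + 1) v) else 0 := by
  split_ifs with h
  · rw [h, stair, MvPolynomial.coeff_X_mul]
  · refine coeff_X_mul_eq_zero ?_ u
    simp [stair, stair_apply_of_lt p.lt_succ_self, Ne.symm h]

theorem pathMatrix_mulVec (j : Fin g) (u : Fin (n + 1) → MvPolynomial (Fin g × ℕ) k)
    (s : Fin (n + 1)) :
    (pathMatrix k g n j *ᵥ u) s = MvPolynomial.X (j, 2 * (s : ℕ)) * u s +
      if h : s.1 < n then MvPolynomial.X (j, 2 * (s : ℕ) + 1) * u ⟨s + 1, Nat.succ_lt_succ h⟩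
      else 0 := by
  rw [Matrix.mulVec, dotProduct, ← Finset.add_sum_erase _ _ (Finset.mem_univ s)]
  congr 1
  · simp [pathMatrix, two_mul]
  · split_ifs with h
    · rw [Finset.sum_eq_single ⟨s + 1, Nat.succ_lt_succ h⟩]
      · simp [pathMatrix, two_mul, add_assoc]
      · intro t ht hts
        have : ¬(s.1 = t ∨ s.1 + 1 = t) := by grind [Fin.ext_iff]
        simp [pathMatrix, this]
      · grind [Fin.ext_iff]
    · refine Finset.sum_eq_zero fun t ht => ?_
      have : ¬(s.1 = t ∨ s.1 + 1 = t) := by grind [Fin.ext_iff]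
      simp [pathMatrix, this]

/-- The polynomial summing the weights of all walks from the vertex `s` that spell `w`. -/
def walkSum (k : Type*) [Field k] {g : ℕ} (n : ℕ) (w : List (Fin g)) :
    Fin (n + 1) → MvPolynomial (Fin g × ℕ) k :=
  (w.map (pathMatrix k g n)).prod *ᵥ 1

theorem walkSum_nil : walkSum k n ([] : List (Fin g)) = 1 := by
  simp [walkSum]

theorem walkSum_cons (j : Fin g) (w : List (Fin g)) (s : Fin (n + 1)) :
    walkSum k n (j :: w) s = MvPolynomial.X (j, 2 * (s : ℕ)) * walkSum k n w s +
      if h : s.1 < n then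
        MvPolynomial.X (j, 2 * (s : ℕ) + 1) * walkSum k n w ⟨s + 1, Nat.succ_lt_succ h⟩
      else 0 := by
  rw [walkSum, List.map_cons, List.prod_cons, ← Matrix.mulVec_mulVec, pathMatrix_mulVec]
  rfl

theorem coeff_walkSum_eq_zero {j : Fin g} {q : ℕ} (w : List (Fin g)) {s : Fin (n + 1)}
    (hq : q < 2 * (s : ℕ)) {e : Fin g × ℕ →₀ ℕ} (he : e (j, q) ≠ 0) :
    (walkSum k n w s).coeff e = 0 := by
  classical
  induction w generalizing e s with
  | nil =>
    rw [walkSum_nil, Pi.one_apply, MvPolynomial.coeff_one, if_neg]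
    rintro rfl
    exact he rfl
  | cons i w ih =>
    rw [walkSum_cons, MvPolynomial.coeff_add,
      coeff_X_mul_eq_zero_of_apply_ne_zero (fun _ => ih hq) (by simp [hq.ne']) he, zero_add]
    split_ifs with h
    · exact coeff_X_mul_eq_zero_of_apply_ne_zero (fun _ => ih (by simp; omega))
        (by simp; omega) he
    · exact MvPolynomial.coeff_zero e

theorem coeff_stair_walkSum (v w : List (Fin g)) {p : ℕ} {s : Fin (n + 1)} (hs : p / 2 = s)
    (hp : p + v.length ≤ 2 * n + 1) :
    (walkSum k n w s).coeff (stair p v) = if w = v then 1 else 0 := by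
  classical
  induction v generalizing p w s with
  | nil =>
    cases w with
    | nil => simp [walkSum_nil, stair]
    | cons i w =>
      have hX : ∀ x (u : MvPolynomial (Fin g × ℕ) k),
          (MvPolynomial.X x * u).coeff (stair p []) = 0 := fun x u => coeff_X_mul_eq_zero rfl u
      rw [walkSum_cons, MvPolynomial.coeff_add, hX, zero_add]
      split_ifs <;> simp_all
  | cons j v ih =>
    cases w with
    | nil => simp [walkSum_nil, MvPolynomial.coeff_one, (stair_cons_ne_zero p j v).symm]
    | cons i w =>
      have hstep : ∀ t : Fin (n + 1), (p + 1) / 2 = t →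
          (MvPolynomial.X (i, p) * walkSum k n w t).coeff (stair p (j :: v)) =
            if i :: w = j :: v then 1 else 0 := fun t ht => by
        rw [coeff_stair_cons_X_mul, ih w ht (by simp at hp; omega)]
        grind
      rw [walkSum_cons, MvPolynomial.coeff_add, apply_dite (MvPolynomial.coeff _)]
      obtain rfl | rfl : p = 2 * s ∨ p = 2 * s + 1 := by omega
      · rw [hstep s (by omega), dite_eq_right_iff.mpr, MvPolynomial.coeff_zero, add_zero]
        exact fun h => coeff_X_mul_eq_zero_of_apply_ne_zero (y := (j, 2 * (s : ℕ)))
          (fun _ => coeff_walkSum_eq_zero w (by simp)) (by simp) (by simp [stair])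
      · rw [coeff_X_mul_eq_zero (stair_apply_of_lt (Nat.lt_succ_self _) _ _), zero_add,
          dif_pos (by simp at hp; omega), hstep _ (by simp; omega)]

end Stair

section PolyAtom

variable {k : Type*} [Field k] {g n : ℕ} {f : FreeAlgebra k (Fin g)}

theorem coeff_stair_lift_pathMatrix (f : FreeAlgebra k (Fin g)) {v : FreeMonoid (Fin g)}
    (hv : v.length ≤ 2 * n + 1) :
    ((FreeAlgebra.lift k (pathMatrix k g n) f *ᵥ 1) 0).coeff (stair 0 v.toList) =
      wordCoeff v f := by
  suffices MvPolynomial.lcoeff k (stair 0 v.toList) ∘ₗ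
      (LinearMap.proj (0 : Fin (n + 1)) ∘ₗ (Matrix.mulVecBilin k k).flip 1) ∘ₗ
        (FreeAlgebra.lift k (pathMatrix k g n)).toLinearMap = wordCoeff v from
    LinearMap.congr_fun this f
  classical
  refine (FreeAlgebra.basisFreeMonoid k (Fin g)).ext fun w => ?_
  have hw := coeff_stair_walkSum (k := k) v.toList w.toList (p := 0) (s := (0 : Fin (n + 1))) rfl
    (by rwa [zero_add])
  simpa [walkSum, lift_basisFreeMonoid, FreeMonoid.lift_apply, wordCoeff, Finsupp.single_apply]
    using hw

theorem isConstant_of_isUnit_det (hf : ncDegree f < 2 * n) (h : IsUnit (polyEval f n).det) :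
    IsConstant f := by
  obtain ⟨n, rfl⟩ : ∃ m, n = m + 1 := ⟨n - 1, by omega⟩
  obtain ⟨c, hc⟩ := exists_lift_pathMatrix_eq_diagonal h
  refine isConstant_of_wordCoeff_eq_zero fun v hv => ?_
  rcases le_or_gt v.length (2 * n + 1) with hlen | hlen
  · rw [← coeff_stair_lift_pathMatrix f hlen, hc]
    have hstair : stair 0 v.toList ≠ 0 := by
      cases v with
      | one => exact absurd rfl hv
      | of_mul j v => exact stair_cons_ne_zero 0 j v.toList
    simp [Matrix.mulVec_diagonal, MvPolynomial.coeff_C, hstair.symm]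
  · exact wordCoeff_eq_zero_of_ncDegree_lt (by omega)

theorem not_isConstant_of_irreducible_det (h : Irreducible (polyEval f n).det) :
    ¬ IsConstant f := by
  rintro ⟨c, rfl⟩
  have hdet : (polyEval (algebraMap k (FreeAlgebra k (Fin g)) c) n).det =
      algebraMap k _ (c ^ n) := by
    simp [polyEval, Matrix.algebraMap_eq_diagonal]
  rw [hdet] at h
  rcases eq_or_ne (c ^ n) 0 with hc | hc
  · exact h.ne_zero (by rw [hc, map_zero])
  · exact h.not_isUnit (hc.isUnit.map (algebraMap k _))

theorem isPolyAtom_of_irreducible_det (hn : ncDegree f ≤ 2 * n)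
    (h : Irreducible (polyEval f n).det) : IsPolyAtom f := by
  refine ⟨not_isConstant_of_irreducible_det h, ?_⟩
  rintro ⟨f₁, f₂, h₁, h₂, rfl⟩
  have hne : ∀ {p : FreeAlgebra k (Fin g)}, ¬ IsConstant p → p ≠ 0 := by
    rintro p hp rfl
    exact hp ⟨0, (map_zero _).symm⟩
  have hdeg := ncDegree_add_le_ncDegree_mul (hne h₁) (hne h₂)
  have hdeg₁ : ncDegree f₁ ≠ 0 := fun h0 => h₁ (isConstant_of_ncDegree_eq_zero h0)
  have hdeg₂ : ncDegree f₂ ≠ 0 := fun h0 => h₂ (isConstant_of_ncDegree_eq_zero h0)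
  have hmul : (polyEval (f₁ * f₂) n).det = (polyEval f₁ n).det * (polyEval f₂ n).det := by
    simp only [polyEval, map_mul, Matrix.det_mul]
  rcases h.isUnit_or_isUnit hmul with hu | hu
  · exact h₁ (isConstant_of_isUnit_det (by omega) hu)
  · exact h₂ (isConstant_of_isUnit_det (by omega) hu)

end PolyAtom

section JointlyNilpotent

variable {ι : Type*}

/-- A family of elements of a monoid with zero is jointly nilpotent if all its words of some fixed
length vanish. -/
def IsJointlyNilpotent {M : Type*} [MonoidWithZero M] (A : ι → M) : Prop :=
  ∃ N, ∀ w : FreeMonoid ι, w.length = N → FreeMonoid.lift A w = 0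

theorem IsJointlyNilpotent.of_subsingleton {M : Type*} [MonoidWithZero M] [Subsingleton M]
    (A : ι → M) : IsJointlyNilpotent A :=
  ⟨0, fun _ _ => Subsingleton.elim _ _⟩

theorem isJointlyNilpotent_map_iff {M N F : Type*} [MonoidWithZero M] [MonoidWithZero N]
    [EquivLike F M N] [MulEquivClass F M N] (e : F) {A : ι → M} :
    IsJointlyNilpotent (e ∘ A) ↔ IsJointlyNilpotent A := by
  have hlift : ∀ w, FreeMonoid.lift (e ∘ A) w = e (FreeMonoid.lift A w) := fun w =>
    (FreeMonoid.hom_map_lift (e : M →* N) A w).symm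
  simp only [IsJointlyNilpotent, hlift, EmbeddingLike.map_eq_zero_iff]

theorem IsJointlyNilpotent.induction {R V : Type*} [Semiring R] [AddCommMonoid V] [Module R V]
    {B : ι → Module.End R V} (hB : IsJointlyNilpotent B) {P : V → Prop} (zero : P 0)
    (step : ∀ v, (∀ j, P (B j v)) → P v) (v : V) : P v := by
  obtain ⟨N, hN⟩ := hB
  suffices ∀ v, (∀ w : FreeMonoid ι, w.length = N → P (FreeMonoid.lift B w v)) → P v from
    this v fun w hw => by simpa [hN w hw] using zero
  clear hN
  induction N with
  | zero => exact fun v hv => by simpa using hv 1 rfl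
  | succ N ih =>
    refine fun v hv => step v fun j => ih _ fun w hw => ?_
    simpa using hv (w * FreeMonoid.of j) (by simp [hw])

end JointlyNilpotent

section Rank

variable {K m : Type*} [Field K] [Fintype m]

theorem rank_eq_zero_iff {M : Matrix m m K} : M.rank = 0 ↔ M = 0 := by
  classical
  rw [Matrix.rank, Submodule.finrank_eq_zero, LinearMap.range_eq_bot, ← Matrix.toLin'_apply',
    LinearEquiv.map_eq_zero_iff]

theorem rank_map_ringHom {F : Type*} [Field F] (φ : K →+* F) (M : Matrix m m K) :
    (M.map φ).rank = M.rank := by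
  classical
  obtain ⟨V, U, e, hV, hU, hM⟩ := M.exists_rank_normal_form
  have hV' := (hV.map φ.mapMatrix).map Matrix.detMonoidHom
  have hU' := (hU.map φ.mapMatrix).map Matrix.detMonoidHom
  have hM' : V.map φ * M.map φ * U.map φ =
      (Matrix.diagonal (Sum.elim 1 0)).submatrix e e := by
    rw [← Matrix.map_mul, ← Matrix.map_mul, hM, ← Matrix.submatrix_map, Matrix.fromBlocks_map]
    simp [Pi.one_def, Pi.zero_def, ← Matrix.fromBlocks_diagonal]
  rw [← Matrix.rank_mul_eq_right_of_isUnit_det (V.map φ) _ hV',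
    ← Matrix.rank_mul_eq_left_of_isUnit_det (U.map φ) _ hU', hM', Matrix.rank_submatrix,
    Matrix.rank_diagonal]
  simp [Fintype.card_congr Equiv.subtypeSum]

theorem rank_mul_mul_of_rank_mul_eq {M N : Matrix m m K} (h : (M * N).rank = N.rank)
    (P : Matrix m m K) : (M * N * P).rank = (N * P).rank := by
  have hker : LinearMap.ker (M * N).mulVecLin = LinearMap.ker N.mulVecLin := by
    refine (Submodule.eq_of_le_of_finrank_eq ?_ ?_).symm
    · rw [Matrix.mulVecLin_mul]
      exact LinearMap.ker_le_ker_comp _ _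
    · have hMN := (M * N).mulVecLin.finrank_range_add_finrank_ker
      have hN := N.mulVecLin.finrank_range_add_finrank_ker
      rw [← Matrix.rank] at hMN hN
      omega
  have hkerP : LinearMap.ker (M * N * P).mulVecLin = LinearMap.ker (N * P).mulVecLin := by
    rw [Matrix.mulVecLin_mul, LinearMap.ker_comp, hker, ← LinearMap.ker_comp,
      ← Matrix.mulVecLin_mul]
  have hMNP := (M * N * P).mulVecLin.finrank_range_add_finrank_ker
  have hNP := (N * P).mulVecLin.finrank_range_add_finrank_ker
  rw [← Matrix.rank] at hMNP hNP
  rw [hkerP] at hMNP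
  omega

theorem rank_mul_pow_succ [DecidableEq m] {M N : Matrix m m K} (hMN : (M * N).rank = N.rank)
    (hNM : (N * M).rank = M.rank) (i : ℕ) : ((M * N) ^ (i + 1)).rank = (M * N).rank := by
  induction i with
  | zero => simp
  | succ i ih =>
    calc ((M * N) ^ (i + 2)).rank
        = (M * N * (M * (N * (M * N) ^ i))).rank := by simp only [pow_succ', mul_assoc]
      _ = (N * M * (N * (M * N) ^ i)).rank := by
          rw [rank_mul_mul_of_rank_mul_eq hMN, mul_assoc]
      _ = ((M * N) ^ (i + 1)).rank := by
          rw [rank_mul_mul_of_rank_mul_eq hNM, pow_succ', mul_assoc]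
      _ = (M * N).rank := ih

theorem not_isNilpotent_mul [DecidableEq m] {M N : Matrix m m K} (hMN : (M * N).rank = N.rank)
    (hNM : (N * M).rank = M.rank) (h : (M * N).rank ≠ 0) : ¬ IsNilpotent (M * N) := by
  rintro ⟨i, hi⟩
  rw [← rank_mul_pow_succ hMN hNM i, pow_succ, hi, zero_mul, Matrix.rank_zero] at h
  exact h rfl

theorem isNilpotent_of_isUnit_charpolyRev [DecidableEq m] {Z : Matrix m m K}
    (h : IsUnit Z.charpolyRev) : IsNilpotent Z := by
  have hdeg := Polynomial.natDegree_eq_zero_of_isUnit h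
  rw [← Matrix.reverse_charpoly, Polynomial.reverse_natDegree, Nat.sub_eq_zero_iff_le] at hdeg
  have hX : Z.charpoly = Polynomial.X ^ Z.charpoly.natDegree :=
    Z.charpoly_monic.eq_X_pow_iff_natTrailingDegree_eq_natDegree.mpr <|
      (Polynomial.natTrailingDegree_le_natDegree _).antisymm hdeg
  refine ⟨Z.charpoly.natDegree, ?_⟩
  have hZ := Z.aeval_self_charpoly
  rwa [hX, map_pow, Polynomial.aeval_X] at hZ

end Rank

section RankSequence

variable {K m : Type*} [Field K] [Fintype m] [DecidableEq m]
  {T : ℕ → Matrix m m K} {r : ℕ → ℕ}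

/-- The products of distinct members of the sequence `T` have a rank that depends only on the
number of factors; `r` is the sequence of these ranks. -/
def HasProdRank (T : ℕ → Matrix m m K) (r : ℕ → ℕ) : Prop :=
  ∀ l : List ℕ, l.Nodup → (l.map T).prod.rank = r l.length

theorem HasProdRank.apply_zero (h : HasProdRank T r) : r 0 = Fintype.card m := by
  simpa using (h [] List.nodup_nil).symm

theorem HasProdRank.rank_mul (h : HasProdRank T r) {i : ℕ} {l : List ℕ} (hil : (i :: l).Nodup) :
    (T i * (l.map T).prod).rank = r (l.length + 1) := by
  simpa using h _ hil

theorem HasProdRank.antitone (h : HasProdRank T r) : Antitone r := by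
  refine antitone_nat_of_succ_le fun a => ?_
  have hle := Matrix.rank_mul_le_right (T a) ((List.range a).map T).prod
  rwa [h _ List.nodup_range, h.rank_mul (by simp [List.nodup_range]), List.length_range] at hle

theorem HasProdRank.apply_add_two (h : HasProdRank T r) {a : ℕ} (ha : r (a + 1) = r a) :
    r (a + 2) = r (a + 1) := by
  have hrank : (T (a + 1) * ((List.range a).map T).prod).rank =
      ((List.range a).map T).prod.rank := by
    rw [h.rank_mul (by simp [List.nodup_range]), h _ List.nodup_range, List.length_range, ha]
  have hmul := rank_mul_mul_of_rank_mul_eq hrank (T a)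
  have hprod : ((List.range a).map T).prod * T a = ((List.range (a + 1)).map T).prod := by
    simp [List.range_succ]
  rw [mul_assoc, hprod] at hmul
  rwa [h.rank_mul (by simp [List.nodup_range]), h _ List.nodup_range, List.length_range] at hmul

theorem HasProdRank.eq_of_card_le (h : HasProdRank T r) (hpos : ∀ a, r a ≠ 0) {a : ℕ}
    (ha : Fintype.card m ≤ a + 1) : r a = r (Fintype.card m - 1) := by
  have hle : ∀ a, r a ≤ Fintype.card m := fun a => h.apply_zero ▸ h.antitone a.zero_le
  have key := Nat.stabilises_of_monotone (f := fun a => Fintype.card m - r a)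
    (b := Fintype.card m - 1) (n := a) (fun a b hab => Nat.sub_le_sub_left (h.antitone hab) _)
    (fun a => Nat.sub_le_sub_left (Nat.pos_of_ne_zero (hpos a)) _) (fun a heq => ?_) (by omega)
  · have := hle a
    have := hle (Fintype.card m - 1)
    omega
  · have := h.apply_add_two (a := a)
    have := hle a
    have := hle (a + 1)
    omega

theorem HasProdRank.not_isNilpotent_prod (h : HasProdRank T r) (hpos : ∀ a, r a ≠ 0) {n : ℕ}
    (hn : 2 * Fintype.card m ≤ n + 2) : ¬ IsNilpotent ((List.range n).map T).prod := by
  obtain ⟨a, b, rfl, ha, hb⟩ : ∃ a b, n = a + b ∧ Fintype.card m ≤ a + 1 ∧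
      Fintype.card m ≤ b + 1 := ⟨n / 2, n - n / 2, by omega, by omega, by omega⟩
  obtain ⟨l, hl, hrange⟩ : ∃ l, l.length = b ∧ List.range (a + b) = List.range a ++ l :=
    ⟨_, by simp, List.range_add⟩
  have hnodup : (List.range a ++ l).Nodup := hrange ▸ List.nodup_range
  have hconst {c : ℕ} (hc : Fintype.card m ≤ c + 1) : r (a + b) = r c := by
    rw [h.eq_of_card_le hpos hc, h.eq_of_card_le hpos (by omega)]
  have hrank : (((List.range a).map T).prod * (l.map T).prod).rank = r (a + b) := by
    simpa [hl] using h _ hnodup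
  have hrank' : ((l.map T).prod * ((List.range a).map T).prod).rank = r (a + b) := by
    simpa [hl, add_comm] using h _ (List.nodup_append_comm.mp hnodup)
  rw [hrange, List.map_append, List.prod_append]
  refine not_isNilpotent_mul ?_ ?_ (hrank ▸ hpos _)
  · rw [hrank, h l hnodup.of_append_right, hl, hconst hb]
  · rw [hrank', h _ List.nodup_range, List.length_range, hconst ha]

end RankSequence

section GenericComb

variable {k ι m : Type*} [Field k] [Fintype ι] (B : ι → Matrix m m k)

/-- The `i`-th generic linear combination `∑ x_{j,i} B_j` of the matrices `B_j`. -/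
def genericComb (i : ℕ) : Matrix m m (MvPolynomial (ι × ℕ) k) :=
  ∑ j, (MvPolynomial.X (j, i) : MvPolynomial (ι × ℕ) k) • (B j).map MvPolynomial.C

/-- The field of rational functions in the coefficients of the generic linear combinations. -/
abbrev CoeffField (k ι : Type*) [Field k] : Type _ := FractionRing (MvPolynomial (ι × ℕ) k)

/-- `genericComb` over the field of rational functions. -/
def genericCombFrac (i : ℕ) : Matrix m m (CoeffField k ι) :=
  (genericComb B i).map (algebraMap _ _)

theorem exists_perm_map_range_eq {l : List ℕ} (hl : l.Nodup) :
    ∃ σ : Equiv.Perm ℕ, (List.range l.length).map σ = l := by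
  have := Equiv.Perm.isMultiplyPretransitive ℕ l.length
  obtain ⟨σ, hσ⟩ := MulAction.exists_smul_eq (Equiv.Perm ℕ) Fin.valEmbedding
    (⟨l.get, List.nodup_iff_injective_get.mp hl⟩ : Fin l.length ↪ ℕ)
  refine ⟨σ, List.ext_getElem (by simp) fun i _ hi => ?_⟩
  simpa using DFunLike.congr_fun hσ ⟨i, hi⟩

theorem hasProdRank_genericCombFrac [Fintype m] [DecidableEq m] :
    HasProdRank (genericCombFrac B) fun a =>
      ((List.range a).map (genericCombFrac B)).prod.rank := by
  intro l hl
  obtain ⟨σ, hσ⟩ := exists_perm_map_range_eq hl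
  let ρ := MvPolynomial.renameEquiv k (Equiv.prodCongr (Equiv.refl ι) σ)
  let ψ : CoeffField k ι ≃+* CoeffField k ι :=
    IsFractionRing.ringEquivOfRingEquiv ρ.toRingEquiv
  have hT : genericCombFrac B ∘ σ = ψ.toRingHom.mapMatrix ∘ genericCombFrac B := by
    ext i p q
    simp [genericCombFrac, genericComb, Matrix.sum_apply, ψ, ρ]
  conv_lhs => rw [← hσ, List.map_map, hT, ← List.map_map, ← map_list_prod]
  exact rank_map_ringHom _ _

theorem prod_genericCombFrac_ne_zero [Fintype m] [DecidableEq m] {w : FreeMonoid ι}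
    (hw : FreeMonoid.lift B w ≠ 0) :
    ((List.range w.length).map (genericCombFrac B)).prod ≠ 0 := by
  classical
  let ev : MvPolynomial (ι × ℕ) k →+* k :=
    MvPolynomial.eval fun v => if w.toList[v.2]? = some v.1 then 1 else 0
  have hev (i) (hi : i < w.toList.length) :
      ev.mapMatrix (genericComb B i) = B w.toList[i] := by
    ext p q
    simp [genericComb, Matrix.sum_apply, ev, List.getElem?_eq_getElem hi]
  have hw_prod : ev.mapMatrix ((List.range w.length).map (genericComb B)).prod =
      FreeMonoid.lift B w := by
    rw [map_list_prod, FreeMonoid.lift_apply, List.map_map]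
    exact congrArg _ <| List.ext_getElem (by simp [FreeMonoid.length]) fun i hi _ => by
      simpa using hev i (by simpa [FreeMonoid.length] using hi)
  refine fun h => hw ?_
  have hzero : ((List.range w.length).map (genericComb B)).prod = 0 := by
    let φ := algebraMap (MvPolynomial (ι × ℕ) k) (CoeffField k ι)
    have hφ : Function.Injective (φ.mapMatrix (m := m)) :=
      Matrix.map_injective (IsFractionRing.injective _ _)
    exact (map_eq_zero_iff _ hφ).mp (by rw [map_list_prod, List.map_map]; exact h)
  rw [← hw_prod, hzero, map_zero]

theorem not_isNilpotent_prod_genericCombFrac [Fintype m] [DecidableEq m]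
    (hB : ¬ IsJointlyNilpotent B) {n : ℕ} (hn : 2 * Fintype.card m ≤ n + 2) :
    ¬ IsNilpotent ((List.range n).map (genericCombFrac B)).prod := by
  refine (hasProdRank_genericCombFrac B).not_isNilpotent_prod (fun a => ?_) hn
  rw [ne_eq, rank_eq_zero_iff]
  obtain ⟨w, rfl, hw⟩ : ∃ w : FreeMonoid ι, w.length = a ∧ FreeMonoid.lift B w ≠ 0 := by
    simpa [IsJointlyNilpotent] using not_exists.mp hB a
  exact prod_genericCombFrac_ne_zero B hw

end GenericComb

section CyclicShift

variable {R : Type*} [Ring R]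

/-- The weighted cyclic shift: the edge from `i` to `i + 1` of the oriented cycle with `n + 1`
vertices has the weight `T i`. -/
def cyclicShift (T : ℕ → R) (n : ℕ) : Matrix (Fin (n + 1)) (Fin (n + 1)) R :=
  .of fun i i' => if i + 1 = i' then T i else 0

theorem single_vecMul_cyclicShift (T : ℕ → R) (n : ℕ) (i : Fin (n + 1)) (a : R) :
    Pi.single i a ᵥ* cyclicShift T n = Pi.single (i + 1) (a * T i) := by
  ext i'
  simp [cyclicShift, Pi.single_apply, eq_comm]

theorem single_vecMul_cyclicShift_pow (T : ℕ → R) (n : ℕ) (a : R) {i : ℕ} (hi : i ≤ n + 1) :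
    Pi.single 0 a ᵥ* cyclicShift T n ^ i =
      Pi.single (Fin.ofNat (n + 1) i) (a * ((List.range i).map T).prod) := by
  induction i with
  | zero => simp
  | succ i ih =>
    rw [pow_succ, ← Matrix.vecMul_vecMul, ih (by omega), single_vecMul_cyclicShift]
    have hsucc : Fin.ofNat (n + 1) i + 1 = Fin.ofNat (n + 1) (i + 1) := by
      simp [Fin.ext_iff, Fin.val_add]
    rw [hsucc]
    simp [List.range_succ, mul_assoc, Nat.mod_eq_of_lt hi]

theorem isNilpotent_prod_of_isNilpotent_cyclicShift {T : ℕ → R} {n : ℕ}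
    (h : IsNilpotent (cyclicShift T n)) : IsNilpotent ((List.range (n + 1)).map T).prod := by
  obtain ⟨N, hN⟩ := h
  have hpow (i : ℕ) : Pi.single 0 1 ᵥ* (cyclicShift T n ^ (n + 1)) ^ i =
      Pi.single 0 (((List.range (n + 1)).map T).prod ^ i) := by
    induction i with
    | zero => simp
    | succ i ih =>
      rw [pow_succ, ← Matrix.vecMul_vecMul, ih, single_vecMul_cyclicShift_pow T n _ le_rfl,
        pow_succ]
      simp
  refine ⟨N, ?_⟩
  simpa [← pow_mul, mul_comm _ N, pow_mul _ N, hN, eq_comm] using hpow N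

end CyclicShift

section PencilAt

variable {k ι m n S : Type*} [Field k] [Fintype ι] [DecidableEq m] [DecidableEq n]
  [CommRing S] [Algebra k S]

/-- The evaluation of the monic pencil with coefficients `A` at matrices over a commutative
`k`-algebra. -/
def pencilAt (A : ι → Matrix m m k) (X : ι → Matrix n n S) : Matrix (m × n) (m × n) S :=
  1 - ∑ j, (A j).map (algebraMap k S) ⊗ₖ X j

theorem map_pencilAt {S' : Type*} [CommRing S'] [Algebra k S'] (φ : S →ₐ[k] S')
    (A : ι → Matrix m m k) (X : ι → Matrix n n S) :
    (pencilAt A X).map φ = pencilAt A fun j => (X j).map φ := by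
  ext ⟨p, r⟩ ⟨q, s⟩
  simp [pencilAt, Matrix.sum_apply, Matrix.one_apply, apply_ite φ]

theorem pencilEval_eq_pencilAt {g d : ℕ} (A : Fin g → Matrix (Fin d) (Fin d) k) (n : ℕ) :
    pencilEval A n = pencilAt A (genericMatrix k g n) := rfl

theorem isUnit_det_pencilAt {g d : ℕ} {A : Fin g → Matrix (Fin d) (Fin d) k} {n : ℕ}
    (h : IsUnit (pencilEval A n).det) (X : Fin g → Matrix (Fin n) (Fin n) S) :
    IsUnit (pencilAt A X).det := by
  let φ : MvPolynomial (Fin g × Fin n × Fin n) k →ₐ[k] S :=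
    MvPolynomial.aeval fun v => X v.1 v.2.1 v.2.2
  have hX : (fun j => (genericMatrix k g n j).map φ) = X := by
    ext j r s
    simp [genericMatrix, φ]
  have := h.map φ
  rwa [AlgHom.map_det, AlgHom.mapMatrix_apply, pencilEval_eq_pencilAt, map_pencilAt, hX] at this

/-- The matrices at which the pencil with coefficients `B` becomes `1 - tZ`, where `Z` is the block
matrix of the cyclic shift whose weights are the generic linear combinations of the `B_j`. -/
def shiftPoint (k : Type*) {ι : Type*} [Field k] (n : ℕ) (j : ι) :
    Matrix (Fin (n + 1)) (Fin (n + 1)) (CoeffField k ι)[X] :=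
  (Polynomial.X : (CoeffField k ι)[X]) • (cyclicShift (fun i =>
    algebraMap (MvPolynomial (ι × ℕ) k) (CoeffField k ι) (MvPolynomial.X (j, i))) n).map
      Polynomial.C

theorem pencilAt_shiftPoint [Fintype m] (B : ι → Matrix m m k) (n : ℕ) :
    pencilAt B (shiftPoint k n) = 1 - (Polynomial.X : (CoeffField k ι)[X]) •
      ((Matrix.comp _ _ _ _ _ (cyclicShift (genericCombFrac B) n)).submatrix
        Prod.swap Prod.swap).map Polynomial.C := by
  have hC (a : k) : algebraMap k (CoeffField k ι) a =
      algebraMap (MvPolynomial (ι × ℕ) k) (CoeffField k ι) (MvPolynomial.C a) := rfl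
  refine Matrix.ext fun ⟨p, i⟩ ⟨q, i'⟩ => ?_
  by_cases h : i + 1 = i'
  · simp only [pencilAt, shiftPoint, cyclicShift, genericCombFrac, genericComb, Matrix.sub_apply,
      Matrix.sum_apply, Matrix.kroneckerMap_apply, Matrix.map_apply, Matrix.smul_apply,
      Matrix.of_apply, Matrix.submatrix_apply, Prod.swap, Matrix.comp_apply, if_pos h, smul_eq_mul,
      map_sum, map_mul, Finset.mul_sum, IsScalarTower.algebraMap_apply k (CoeffField k ι)
      (CoeffField k ι)[X], hC, Polynomial.algebraMap_eq]
    exact congrArg _ (Finset.sum_congr rfl fun j _ => by ring)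
  · simp [pencilAt, cyclicShift, shiftPoint, Matrix.sum_apply, h]

theorem isJointlyNilpotent_of_isUnit_det {g e n : ℕ} {B : Fin g → Matrix (Fin e) (Fin e) k}
    (hn : n ≠ 0) (he : 2 * e ≤ n + 2) (h : IsUnit (pencilEval B n).det) :
    IsJointlyNilpotent B := by
  obtain ⟨n, rfl⟩ := Nat.exists_eq_succ_of_ne_zero hn
  by_contra hB
  refine not_isNilpotent_prod_genericCombFrac B hB (by simpa using he)
    (isNilpotent_prod_of_isNilpotent_cyclicShift ?_)
  have hunit := isUnit_det_pencilAt h (shiftPoint k n)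
  rw [pencilAt_shiftPoint] at hunit
  have hZ := isNilpotent_of_isUnit_charpolyRev hunit
  let f := (Matrix.compRingEquiv (Fin (n + 1)) (Fin e) (CoeffField k (Fin g))).trans
    (Matrix.reindexAlgEquiv k _ (Equiv.prodComm _ _)).toRingEquiv
  exact (IsNilpotent.map_iff f.injective).mp hZ

end PencilAt

section Block

variable {k ι m n p q S : Type*} [Field k] [Fintype ι] [Fintype m] [DecidableEq m] [Fintype n]
  [DecidableEq n] [Fintype p] [DecidableEq p] [Fintype q] [DecidableEq q] [CommRing S] [Algebra k S]
  {V : Type*} [AddCommGroup V] [Module k V]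

theorem det_pencilAt_mul_mul {P : Matrix m p k} {Q : Matrix p m k} (hQP : Q * P = 1)
    (N : ι → Matrix p p k) (X : ι → Matrix n n S) :
    (pencilAt (fun j => P * N j * Q) X).det = (pencilAt N X).det := by
  let e := algebraMap k S
  have hfactor : ∑ j, (P * N j * Q).map e ⊗ₖ X j =
      P.map e ⊗ₖ (1 : Matrix n n S) *
        ((∑ j, (N j).map e ⊗ₖ X j) * Q.map e ⊗ₖ (1 : Matrix n n S)) := by
    rw [Matrix.sum_mul, Matrix.mul_sum]
    refine Finset.sum_congr rfl fun j _ => ?_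
    rw [← Matrix.mul_kronecker_mul, ← Matrix.mul_kronecker_mul, ← Matrix.map_mul, ← Matrix.map_mul,
      one_mul, mul_one, Matrix.mul_assoc]
  rw [pencilAt, pencilAt, hfactor, Matrix.det_one_sub_mul_comm, Matrix.mul_assoc,
    ← Matrix.mul_kronecker_mul, ← Matrix.map_mul, hQP]
  simp [e]

theorem det_pencilAt_toMatrix_eq (b : Module.Basis m k V) (b' : Module.Basis p k V)
    (f : ι → Module.End k V) (X : ι → Matrix n n S) :
    (pencilAt (fun j => LinearMap.toMatrix b b (f j)) X).det =
      (pencilAt (fun j => LinearMap.toMatrix b' b' (f j)) X).det := by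
  simp_rw [← basis_toMatrix_mul_linearMap_toMatrix_mul_basis_toMatrix b b' b b']
  exact det_pencilAt_mul_mul (by simp) _ X

theorem det_pencilAt_fromBlocks (A : ι → Matrix p p k) (B : ι → Matrix p q k)
    (D : ι → Matrix q q k) (X : ι → Matrix n n S) :
    (pencilAt (fun j => Matrix.fromBlocks (A j) (B j) 0 (D j)) X).det =
      (pencilAt A X).det * (pencilAt D X).det := by
  let C : Matrix (p × n) (q × n) S := - ∑ j, (B j).map (algebraMap k S) ⊗ₖ X j
  have hblocks : (pencilAt (fun j => Matrix.fromBlocks (A j) (B j) 0 (D j)) X).submatrix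
      (Equiv.sumProdDistrib p q n).symm (Equiv.sumProdDistrib p q n).symm =
      Matrix.fromBlocks (pencilAt A X) C 0 (pencilAt D X) := by
    ext (⟨a, r⟩ | ⟨a, r⟩) (⟨c, s⟩ | ⟨c, s⟩) <;>
    simp [pencilAt, C, Matrix.sum_apply, Matrix.one_apply]
  rw [← Matrix.det_fromBlocks_zero₂₁ _ C, ← hblocks, Matrix.det_submatrix_equiv_self]

theorem exists_toMatrix_sumQuot_eq_fromBlocks {f : Module.End k V} {W : Submodule k V}
    (hW : W ≤ W.comap f) (bW : Module.Basis p k W) (bQ : Module.Basis q k (V ⧸ W)) :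
    ∃ B, LinearMap.toMatrix (bW.sumQuot bQ) (bW.sumQuot bQ) f =
      Matrix.fromBlocks (LinearMap.toMatrix bW bW (f.restrict hW)) B 0
        (LinearMap.toMatrix bQ bQ (W.mapQ W f hW)) := by
  refine ⟨(LinearMap.toMatrix (bW.sumQuot bQ) (bW.sumQuot bQ) f).toBlocks₁₂, ?_⟩
  ext (i | i) (j | j)
  · rw [Matrix.fromBlocks_apply₁₁, LinearMap.toMatrix_apply, LinearMap.toMatrix_apply,
      Module.Basis.sumQuot_inl]
    exact Module.Basis.sumQuot_repr_inl_of_mem bW bQ _ (hW (bW j).2) i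
  · rfl
  · simpa [LinearMap.toMatrix_apply] using
      Module.Basis.sumQuot_repr_inr_of_mem bW bQ _ (hW (bW j).2) i
  · rw [Matrix.fromBlocks_apply₂₂, LinearMap.toMatrix_apply, LinearMap.toMatrix_apply,
      Module.Basis.sumQuot_repr_inr, ← Module.Basis.sumQuot_inr bW bQ, W.mapQ_apply,
      Submodule.mkQ_apply]

theorem det_pencilAt_eq_mul {A : ι → Matrix m m k} {W : Submodule k (m → k)}
    (hW : ∀ j, W ≤ W.comap (Matrix.toLin' (A j))) (bW : Module.Basis p k W)
    (bQ : Module.Basis q k ((m → k) ⧸ W)) (X : ι → Matrix n n S) :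
    (pencilAt A X).det =
      (pencilAt (fun j =>
        LinearMap.toMatrix bW bW ((Matrix.toLin' (A j)).restrict (hW j))) X).det *
      (pencilAt (fun j =>
        LinearMap.toMatrix bQ bQ (W.mapQ W (Matrix.toLin' (A j)) (hW j))) X).det := by
  choose B hB using fun j => exists_toMatrix_sumQuot_eq_fromBlocks (hW j) bW bQ
  have hA : A = fun j =>
      LinearMap.toMatrix (Pi.basisFun k m) (Pi.basisFun k m) (Matrix.toLin' (A j)) := by
    simp
  rw [← det_pencilAt_fromBlocks _ B, ← funext hB, ← det_pencilAt_toMatrix_eq (Pi.basisFun k m),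
    ← hA]

end Block

section Strip

variable {R X : Type*} [CommSemiring R]

/-- Right division by the letter `x_j`: keeps the words that end in `x_j` and removes that letter,
so that `f = f(0) + ∑ j, strip j f * x_j`. -/
def strip (j : X) : FreeAlgebra R X →ₗ[R] FreeAlgebra R X :=
  (FreeAlgebra.basisFreeMonoid R X).repr.symm.toLinearMap ∘ₗ
    Finsupp.lcomapDomain (· * FreeMonoid.of j) (mul_left_injective _) ∘ₗ
    (FreeAlgebra.basisFreeMonoid R X).repr.toLinearMap

theorem wordCoeff_strip (w : FreeMonoid X) (j : X) (f : FreeAlgebra R X) :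
    wordCoeff w (strip j f) = wordCoeff (w * FreeMonoid.of j) f := by
  simp [wordCoeff, strip]

theorem strip_algebraMap (j : X) (c : R) : strip j (algebraMap R (FreeAlgebra R X) c) = 0 :=
  ext_wordCoeff fun w => by
    rw [wordCoeff_strip, wordCoeff_algebraMap (by simp), map_zero]

theorem strip_mul_ι_self (f : FreeAlgebra R X) (j : X) : strip j (f * FreeAlgebra.ι R j) = f :=
  ext_wordCoeff fun w => by rw [wordCoeff_strip, wordCoeff_mul_of_mul_ι]

theorem strip_mul_ι_of_ne {i j : X} (h : i ≠ j) (f : FreeAlgebra R X) :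
    strip j (f * FreeAlgebra.ι R i) = 0 :=
  ext_wordCoeff fun w => by
    rw [wordCoeff_strip, map_zero]
    refine wordCoeff_mul_ι_of_forall_ne (fun v hv => h ?_) f
    simpa using (List.append_inj' hv rfl).2

theorem eq_algebraMap_add_sum_strip [Fintype X] (f : FreeAlgebra R X) :
    f = algebraMap R _ (FreeAlgebra.algebraMapInv f) + ∑ j, strip j f * FreeAlgebra.ι R j := by
  classical
  refine ext_wordCoeff fun w => ?_
  rw [map_add, map_sum]
  induction w using reverse_word_induction with
  | one =>
    rw [Finset.sum_eq_zero fun j _ => wordCoeff_mul_ι_of_forall_ne (by simp) _, wordCoeff_one,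
      wordCoeff_one, FreeAlgebra.algebraMap_leftInverse, add_zero]
  | mul_of v i =>
    rw [wordCoeff_algebraMap (by simp), zero_add, ← wordCoeff_strip, ← map_sum, ← wordCoeff_strip,
      map_sum, Finset.sum_eq_single i (fun j _ hj => strip_mul_ι_of_ne hj _) (by simp),
      strip_mul_ι_self]

theorem strip_mul [Finite X] (f : FreeAlgebra R X) {f' : FreeAlgebra R X}
    (h : FreeAlgebra.algebraMapInv f' = 0) (j : X) : strip j (f * f') = f * strip j f' := by
  cases nonempty_fintype X
  conv_lhs => rw [eq_algebraMap_add_sum_strip f', h, map_zero, zero_add, Finset.mul_sum, map_sum]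
  simp_rw [← mul_assoc]
  rw [Finset.sum_eq_single j (fun i _ hi => strip_mul_ι_of_ne hi _) (by simp), strip_mul_ι_self]

theorem strip_comp_mulVec [Finite X] {m n : Type*} [Fintype n]
    (F : Matrix m n (FreeAlgebra R X)) {u : n → FreeAlgebra R X}
    (h : FreeAlgebra.algebraMapInv ∘ u = 0) (j : X) :
    strip j ∘ (F *ᵥ u) = F *ᵥ (strip j ∘ u) := by
  ext i
  simp only [Function.comp_apply, Matrix.mulVec_eq_sum, map_sum, Finset.sum_apply]
  simp [strip_mul _ (congrFun h _)]

theorem exists_forall_wordCoeff_eq_zero {n : Type*} [Finite n] (u : n → FreeAlgebra R X) :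
    ∃ N, ∀ w : FreeMonoid X, N ≤ w.length → ∀ i, wordCoeff w (u i) = 0 := by
  cases nonempty_fintype n
  let N i := ((FreeAlgebra.basisFreeMonoid R X).repr (u i)).support.sup FreeMonoid.length
  refine ⟨Finset.univ.sup N + 1, fun w hw i => ?_⟩
  by_contra hne
  have h₁ : w.length ≤ N i :=
    Finset.le_sup (f := FreeMonoid.length) (Finsupp.mem_support_iff.mpr hne)
  have h₂ : N i ≤ Finset.univ.sup N := Finset.le_sup (Finset.mem_univ i)
  omega

theorem strip_induction {n : Type*} [Finite n] {P : (n → FreeAlgebra R X) → Prop} (zero : P 0)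
    (strip : ∀ u, (∀ j, P (strip j ∘ u)) → P u) (u : n → FreeAlgebra R X) : P u := by
  obtain ⟨N, hN⟩ := exists_forall_wordCoeff_eq_zero u
  induction N generalizing u with
  | zero =>
    have hu : u = 0 := funext fun i => ext_wordCoeff fun w => by simp [hN w (Nat.zero_le _) i]
    exact hu ▸ zero
  | succ N ih =>
    refine strip u fun j => ih _ fun w hw i => ?_
    rw [Function.comp_apply, wordCoeff_strip]
    exact hN _ (by simpa using hw) i

theorem eq_zero_of_mulVec_eq_zero [Finite X] {m n : Type*} [Fintype n]
    {F : Matrix m n (FreeAlgebra R X)}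
    (hF : ∀ v, F.map FreeAlgebra.algebraMapInv *ᵥ v = 0 → v = 0) {u : n → FreeAlgebra R X}
    (hu : F *ᵥ u = 0) : u = 0 := by
  cases nonempty_fintype X
  induction u using strip_induction with
  | zero => rfl
  | strip u ih =>
    have haug : FreeAlgebra.algebraMapInv ∘ u = 0 := hF _ <| by
      ext i
      simpa [hu] using (RingHom.map_mulVec FreeAlgebra.algebraMapInv.toRingHom F u i).symm
    have hstrip : ∀ j, strip j ∘ u = 0 := fun j => ih j <| by
      rw [← strip_comp_mulVec F haug, hu]
      ext
      simp
    ext i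
    rw [eq_algebraMap_add_sum_strip (u i)]
    have h₀ : FreeAlgebra.algebraMapInv (u i) = 0 := congrFun haug i
    have h₁ : ∀ j, strip j (u i) = 0 := fun j => congrFun (hstrip j) i
    simp [h₀, h₁]

end Strip

section Factorization

variable {k : Type*} [Field k] {g d : ℕ}

/-- The coefficient at `x_j` on the right of what remains of the column vector `u` after subtracting
`L u(0)`, where `L = I - ∑ A_j x_j`; see `monicPencil_mulVec_add_sum`. -/
def reduceVec (A : Fin g → Matrix (Fin d) (Fin d) k) (j : Fin g)
    (u : Fin d → FreeAlgebra k (Fin g)) : Fin d → FreeAlgebra k (Fin g) :=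
  algebraMap k _ ∘ (A j *ᵥ (FreeAlgebra.algebraMapInv ∘ u)) + strip j ∘ u

theorem monicPencil_mulVec (A : Fin g → Matrix (Fin d) (Fin d) k) (v : Fin d → k) :
    monicPencil A *ᵥ (algebraMap k _ ∘ v) = algebraMap k _ ∘ v -
      ∑ j, MulOpposite.op (FreeAlgebra.ι k j) • (algebraMap k _ ∘ (A j *ᵥ v)) := by
  rw [monicPencil, Matrix.sub_mulVec, Matrix.one_mulVec, Matrix.sum_mulVec]
  congr 1
  refine Finset.sum_congr rfl fun j _ => ?_
  ext i
  simp only [Matrix.mulVec, dotProduct, Matrix.map_apply, Function.comp_apply, Pi.smul_apply,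
    op_smul_eq_mul, map_sum, map_mul, Finset.sum_mul]
  refine Finset.sum_congr rfl fun l _ => ?_
  rw [smul_mul_assoc, ← Algebra.commutes, Algebra.smul_def, mul_assoc]

theorem monicPencil_mulVec_add_sum (A : Fin g → Matrix (Fin d) (Fin d) k)
    (u : Fin d → FreeAlgebra k (Fin g)) :
    monicPencil A *ᵥ (algebraMap k _ ∘ (FreeAlgebra.algebraMapInv ∘ u)) +
      ∑ j, MulOpposite.op (FreeAlgebra.ι k j) • reduceVec A j u = u := by
  ext i
  conv_rhs => rw [eq_algebraMap_add_sum_strip (u i)]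
  rw [monicPencil_mulVec]
  simp only [reduceVec, Pi.add_apply, Pi.sub_apply, Finset.sum_apply, Pi.smul_apply,
    Function.comp_apply, op_smul_eq_mul, add_mul, Finset.sum_add_distrib]
  abel

theorem map_algebraMapInv_monicPencil (A : Fin g → Matrix (Fin d) (Fin d) k) :
    (monicPencil A).map FreeAlgebra.algebraMapInv = 1 := by
  ext p q
  simp [monicPencil, Matrix.sum_apply, FreeAlgebra.algebraMapInv, Matrix.one_apply, apply_ite]

theorem reduceVec_algebraMap_add (A : Fin g → Matrix (Fin d) (Fin d) k) (j : Fin g) (c : Fin d → k)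
    (u : Fin d → FreeAlgebra k (Fin g)) :
    reduceVec A j (algebraMap k _ ∘ c + u) =
      algebraMap k _ ∘ (A j *ᵥ (c + FreeAlgebra.algebraMapInv ∘ u)) + strip j ∘ u := by
  have hc : FreeAlgebra.algebraMapInv ∘ (algebraMap k (FreeAlgebra k (Fin g)) ∘ c + u) =
      c + FreeAlgebra.algebraMapInv ∘ u := by
    ext
    simp [FreeAlgebra.algebraMapInv]
  have hstrip : strip j ∘ (algebraMap k (FreeAlgebra k (Fin g)) ∘ c + u) = strip j ∘ u := by
    ext
    simp [strip_algebraMap]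
  rw [reduceVec, hc, hstrip]

theorem reduceVec_induction (A : Fin g → Matrix (Fin d) (Fin d) k)
    {P : (Fin d → FreeAlgebra k (Fin g)) → Prop} (const : ∀ v, P (algebraMap k _ ∘ v))
    (reduce : ∀ u, (∀ j, P (reduceVec A j u)) → P u) (u : Fin d → FreeAlgebra k (Fin g)) : P u := by
  suffices h : ∀ c, P (algebraMap k _ ∘ c + u) by
    simpa [Pi.comp_zero, ← Pi.zero_def] using h 0
  induction u using strip_induction with
  | zero => exact fun c => by simpa using const c
  | strip u ih =>
    refine fun c => reduce _ fun j => ?_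
    rw [reduceVec_algebraMap_add]
    exact ih j _

variable {A : Fin g → Matrix (Fin d) (Fin d) k}
  {F G : Matrix (Fin d) (Fin d) (FreeAlgebra k (Fin g))}

theorem mulVec_eq_zero_of_mul_eq_monicPencil (h : F * G = monicPencil A)
    {v : Fin d → k} (hv : F.map FreeAlgebra.algebraMapInv *ᵥ v = 0) : v = 0 := by
  have hFG : F.map FreeAlgebra.algebraMapInv * G.map FreeAlgebra.algebraMapInv = 1 := by
    rw [← map_algebraMapInv_monicPencil A, ← h]
    exact (Matrix.map_mul (f := FreeAlgebra.algebraMapInv.toRingHom)).symm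
  rw [← Matrix.one_mulVec v, ← mul_eq_one_comm.mp hFG, ← Matrix.mulVec_mulVec, hv,
    Matrix.mulVec_zero]

theorem mem_range_mulVec_iff_reduceVec (h : F * G = monicPencil A)
    {u : Fin d → FreeAlgebra k (Fin g)} :
    u ∈ Set.range F.mulVec ↔ ∀ j, reduceVec A j u ∈ Set.range F.mulVec := by
  let c : Fin d → FreeAlgebra k (Fin g) := algebraMap k _ ∘ (FreeAlgebra.algebraMapInv ∘ u)
  have hu : F *ᵥ (G *ᵥ c) + ∑ j, MulOpposite.op (FreeAlgebra.ι k j) • reduceVec A j u = u := by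
    rw [Matrix.mulVec_mulVec, h, monicPencil_mulVec_add_sum]
  constructor
  · rintro ⟨y, hy⟩ j
    let z := y - G *ᵥ c
    have hz : F *ᵥ z = ∑ j, MulOpposite.op (FreeAlgebra.ι k j) • reduceVec A j u := by
      rw [Matrix.mulVec_sub, hy, sub_eq_iff_eq_add', hu]
    have hz₀ : FreeAlgebra.algebraMapInv ∘ z = 0 := by
      apply mulVec_eq_zero_of_mul_eq_monicPencil h
      ext i
      have := RingHom.map_mulVec FreeAlgebra.algebraMapInv.toRingHom F z i
      simpa [hz, FreeAlgebra.algebraMapInv] using this.symm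
    refine ⟨strip j ∘ z, ?_⟩
    rw [← strip_comp_mulVec F hz₀, hz]
    ext i
    simp only [Function.comp_apply, Finset.sum_apply, Pi.smul_apply, op_smul_eq_mul, map_sum]
    rw [Finset.sum_eq_single j (fun i _ hi => strip_mul_ι_of_ne hi _) (by simp), strip_mul_ι_self]
  · intro hF
    choose y hy using hF
    refine ⟨G *ᵥ c + ∑ j, MulOpposite.op (FreeAlgebra.ι k j) • y j, ?_⟩
    conv_rhs => rw [← hu]
    simp only [Matrix.mulVec_add, Matrix.mulVec_sum, Matrix.mulVec_smul, hy]

/-- The constant vectors in the right column space of a matrix over the free algebra. -/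
def constRange (F : Matrix (Fin d) (Fin d) (FreeAlgebra k (Fin g))) : Submodule k (Fin d → k) where
  carrier := {v | algebraMap k _ ∘ v ∈ Set.range F.mulVec}
  zero_mem' := ⟨0, by ext; simp⟩
  add_mem' := by
    rintro v v' ⟨y, hy⟩ ⟨y', hy'⟩
    refine ⟨y + y', ?_⟩
    rw [Matrix.mulVec_add, hy, hy']
    ext
    simp
  smul_mem' := by
    rintro c v ⟨y, hy⟩
    refine ⟨c • y, ?_⟩
    rw [Matrix.mulVec_smul, hy]
    ext
    simp [Algebra.smul_def]

theorem mem_constRange {F : Matrix (Fin d) (Fin d) (FreeAlgebra k (Fin g))} {v : Fin d → k} :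
    v ∈ constRange F ↔ algebraMap k _ ∘ v ∈ Set.range F.mulVec :=
  Iff.rfl

theorem mem_constRange_iff (h : F * G = monicPencil A) {v : Fin d → k} :
    v ∈ constRange F ↔ ∀ j, A j *ᵥ v ∈ constRange F := by
  have hreduce (j) : reduceVec A j (algebraMap k _ ∘ v) = algebraMap k _ ∘ (A j *ᵥ v) := by
    simpa [Pi.comp_zero, ← Pi.zero_def] using reduceVec_algebraMap_add A j v 0
  rw [mem_constRange, mem_range_mulVec_iff_reduceVec h]
  simp only [hreduce, mem_constRange]

theorem range_mulVec_subset (h : F * G = monicPencil A) {F' G'} (h' : F' * G' = monicPencil A)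
    (hle : constRange F ≤ constRange F') : Set.range F.mulVec ⊆ Set.range F'.mulVec := by
  intro u
  induction u using reduceVec_induction A with
  | const v => exact fun hv => hle hv
  | reduce u ih =>
    exact fun hu => (mem_range_mulVec_iff_reduceVec h').mpr fun j =>
      ih j ((mem_range_mulVec_iff_reduceVec h).mp hu j)

theorem exists_mul_eq_of_range_mulVec_subset {S m n : Type*} [Semiring S] [Fintype n]
    {F F' : Matrix m n S} (h : Set.range F.mulVec ⊆ Set.range F'.mulVec) :
    ∃ H : Matrix n n S, F' * H = F := by
  classical
  have hcol : ∀ j, ∃ y, F' *ᵥ y = F.col j := fun j =>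
    h ⟨Pi.single j 1, Matrix.mulVec_single_one F j⟩
  choose y hy using hcol
  refine ⟨(Matrix.of y)ᵀ, ?_⟩
  ext i j
  exact congrFun (hy j) i

end Factorization

section Regular

variable {k : Type*} [Field k] {g d : ℕ}

theorem isLeftRegular_of_mul_eq_monicPencil {A : Fin g → Matrix (Fin d) (Fin d) k}
    {F G : Matrix (Fin d) (Fin d) (FreeAlgebra k (Fin g))} (h : F * G = monicPencil A) :
    IsLeftRegular F := by
  refine isLeftRegular_iff_right_eq_zero_of_mul.mpr fun Y hY => Matrix.ext_col fun j => ?_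
  refine eq_zero_of_mulVec_eq_zero (F := F)
    (fun v => mulVec_eq_zero_of_mul_eq_monicPencil h) ?_
  ext i
  exact congrFun₂ hY i j

theorem isRightRegular_monicPencil (A : Fin g → Matrix (Fin d) (Fin d) k) :
    IsRightRegular (monicPencil A) := by
  refine isRightRegular_iff_left_eq_zero_of_mul.mpr fun Y hY => ?_
  have hY' : ∀ p q, Y p q = ∑ j, (∑ l, A j l q • Y p l) * FreeAlgebra.ι k j := by
    intro p q
    have := congrFun₂ hY p q
    rw [monicPencil, mul_sub, mul_one, Matrix.sub_apply, Matrix.zero_apply, sub_eq_zero] at this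
    rw [this, Finset.mul_sum, Matrix.sum_apply]
    simp [Matrix.mul_apply, Finset.sum_mul]
  suffices ∀ w p q, wordCoeff w (Y p q) = 0 from
    Matrix.ext fun p q => ext_wordCoeff fun w => by simp [this]
  intro w
  induction w using reverse_word_induction with
  | one =>
    intro p q
    rw [hY', map_sum]
    exact Finset.sum_eq_zero fun j _ => wordCoeff_mul_ι_of_forall_ne (by simp) _
  | mul_of v i ih =>
    intro p q
    rw [← wordCoeff_strip, hY', map_sum,
      Finset.sum_eq_single i (fun j _ hj => strip_mul_ι_of_ne hj _) (by simp),
      strip_mul_ι_self, map_sum]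
    exact Finset.sum_eq_zero fun l _ => by rw [map_smul, ih, smul_zero]

theorem isRegular_monicPencil (A : Fin g → Matrix (Fin d) (Fin d) k) :
    IsRegular (monicPencil A) :=
  ⟨isLeftRegular_of_mul_eq_monicPencil (mul_one _), isRightRegular_monicPencil A⟩

end Regular

section Factors

variable {k : Type*} [Field k] {g d : ℕ} {A : Fin g → Matrix (Fin d) (Fin d) k}
  {F G : Matrix (Fin d) (Fin d) (FreeAlgebra k (Fin g))}

theorem isUnit_left_of_constRange_eq_top (h : F * G = monicPencil A) (htop : constRange F = ⊤) :
    IsUnit F := by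
  obtain ⟨H, hFH⟩ := exists_mul_eq_of_range_mulVec_subset
    (range_mulVec_subset (one_mul (monicPencil A)) h (htop ▸ le_top))
  have hHF : H * F = 1 := isLeftRegular_of_mul_eq_monicPencil h <| by
    simp only [← mul_assoc, hFH, one_mul, mul_one]
  exact ⟨⟨F, H, hFH, hHF⟩, rfl⟩

theorem isUnit_right_of_constRange_le (h : F * G = monicPencil A)
    (hle : constRange F ≤ constRange (monicPencil A)) : IsUnit G := by
  obtain ⟨H, hLH⟩ := exists_mul_eq_of_range_mulVec_subset
    (range_mulVec_subset h (mul_one (monicPencil A)) hle)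
  have hGH : G * H = 1 := isLeftRegular_of_mul_eq_monicPencil h <| by
    simp only [← mul_assoc, h, hLH, mul_one]
  have hHG : H * G = 1 := isLeftRegular_of_mul_eq_monicPencil (mul_one (monicPencil A)) <| by
    simp only [← mul_assoc, h, hLH, mul_one]
  exact ⟨⟨G, H, hGH, hHG⟩, rfl⟩

end Factors

section Atoms

variable {k : Type*} [Field k] {g d n : ℕ} {A : Fin g → Matrix (Fin d) (Fin d) k}
  {F G : Matrix (Fin d) (Fin d) (FreeAlgebra k (Fin g))}

theorem isJointlyNilpotent_toMatrix_iff {ι m V : Type*} [Fintype m] [DecidableEq m]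
    [AddCommGroup V] [Module k V] (b : Module.Basis m k V) {f : ι → Module.End k V} :
    IsJointlyNilpotent (fun j => LinearMap.toMatrix b b (f j)) ↔ IsJointlyNilpotent f :=
  isJointlyNilpotent_map_iff (LinearMap.toMatrixAlgEquiv b)

theorem constRange_le_comap (h : F * G = monicPencil A) (j : Fin g) :
    constRange F ≤ (constRange F).comap (Matrix.toLin' (A j)) :=
  fun _ hv => (mem_constRange_iff h).mp hv j

theorem isUnit_left_of_isJointlyNilpotent_mapQ (h : F * G = monicPencil A)
    (hA : IsJointlyNilpotent fun j =>
      (constRange F).mapQ (constRange F) (Matrix.toLin' (A j)) (constRange_le_comap h j)) :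
    IsUnit F := by
  refine isUnit_left_of_constRange_eq_top h (Submodule.eq_top_iff'.mpr fun v => ?_)
  rw [← Submodule.Quotient.mk_eq_zero]
  refine hA.induction (P := (· = 0)) rfl (fun x hx => ?_) _
  obtain ⟨v, rfl⟩ := Submodule.Quotient.mk_surjective _ x
  simp only [Submodule.mapQ_apply, Submodule.Quotient.mk_eq_zero, Matrix.toLin'_apply] at hx
  exact (Submodule.Quotient.mk_eq_zero _).mpr ((mem_constRange_iff h).mpr hx)

theorem isUnit_right_of_isJointlyNilpotent_restrict (h : F * G = monicPencil A)
    (hA : IsJointlyNilpotent fun j =>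
      ((Matrix.toLin' (A j)).restrict (constRange_le_comap h j) : Module.End k (constRange F))) :
    IsUnit G :=
  isUnit_right_of_constRange_le h fun v hv =>
    hA.induction (P := fun v => (v : Fin d → k) ∈ constRange (monicPencil A))
      (Submodule.zero_mem _) (fun _ => (mem_constRange_iff (mul_one _)).mpr) ⟨v, hv⟩

theorem not_isUnit_monicPencil (h : ¬ IsUnit (pencilEval A n).det) : ¬ IsUnit (monicPencil A) := by
  let ev := (Matrix.compRingEquiv (Fin d) (Fin n)
    (MvPolynomial (Fin g × Fin n × Fin n) k)).toRingHom.comp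
      (FreeAlgebra.lift k (genericMatrix k g n)).toRingHom.mapMatrix
  have hev : pencilEval A n = ev (monicPencil A) :=
    Matrix.ext fun ⟨p, r⟩ ⟨q, s⟩ => pencilEval_apply A n p q r s
  rw [hev, ← Matrix.isUnit_iff_isUnit_det] at h
  exact fun hA => h (hA.map ev)

theorem isUnit_or_isUnit_of_mul_eq_monicPencil (hn : 2 * d ≤ n + 4)
    (hA : Irreducible (pencilEval A n).det) (h : F * G = monicPencil A) :
    IsUnit F ∨ IsUnit G := by
  let W := constRange F
  let bW := Module.finBasis k W
  let bQ := Module.finBasis k ((Fin d → k) ⧸ W)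
  have hn₀ : n ≠ 0 := by
    rintro rfl
    exact hA.not_isUnit (by simp)
  have hdim := W.finrank_quotient_add_finrank
  rw [Module.finrank_fin_fun] at hdim
  by_contra! hFG
  have hquot := mt (isUnit_left_of_isJointlyNilpotent_mapQ h) hFG.1
  have hrestr := mt (isUnit_right_of_isJointlyNilpotent_restrict h) hFG.2
  have hW₀ : Module.finrank k W ≠ 0 := fun h₀ =>
    have := Module.finrank_zero_iff.mp h₀
    hrestr (.of_subsingleton _)
  have hQ₀ : Module.finrank k ((Fin d → k) ⧸ W) ≠ 0 := fun h₀ =>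
    have := Module.finrank_zero_iff.mp h₀
    hquot (.of_subsingleton _)
  rw [← isJointlyNilpotent_toMatrix_iff bW] at hrestr
  rw [← isJointlyNilpotent_toMatrix_iff bQ] at hquot
  rcases hA.isUnit_or_isUnit (det_pencilAt_eq_mul (constRange_le_comap h) bW bQ _) with hu | hu
  · exact hrestr (isJointlyNilpotent_of_isUnit_det hn₀ (by lia) hu)
  · exact hquot (isJointlyNilpotent_of_isUnit_det hn₀ (by lia) hu)

theorem isMatrixAtom_of_irreducible_det (hn : 2 * d ≤ n + 4)
    (h : Irreducible (pencilEval A n).det) : IsMatrixAtom (monicPencil A) := by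
  refine ⟨isRegular_monicPencil A, not_isUnit_monicPencil h.not_isUnit, ?_⟩
  rintro ⟨F, G, hF, hG, hFG⟩
  exact (isUnit_or_isUnit_of_mul_eq_monicPencil hn h hFG.symm).elim hF hG

end Atoms

section Bounds

theorem le_two_mul_of_n₁_le {δ n : ℕ} (h : n₁ δ ≤ n) : δ ≤ 2 * n := by
  have hδ : (δ : ℝ) / 2 ≤ n := Nat.ceil_le.mp h
  rify
  linarith

theorem two_mul_le_n₂_add_four {d : ℕ} (hd : 1 < d) : 2 * d ≤ n₂ d + 4 := by
  rcases eq_or_ne d 2 with rfl | hd₂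
  · simp
  have hd₃ : (3 : ℝ) ≤ d := by exact_mod_cast (show 3 ≤ d by lia)
  have hquot : 2 ≤ 2 * ((d : ℝ) - 1) ^ 2 / (d - 2) := by
    rw [le_div_iff₀ (by linarith)]
    nlinarith
  have hsqrt : 3 / 2 ≤ √(2 * ((d : ℝ) - 1) ^ 2 / (d - 2) + 1 / 4) :=
    Real.le_sqrt_of_sq_le (by linarith)
  have hmul := mul_le_mul_of_nonneg_left hsqrt (show 0 ≤ (d : ℝ) - 1 by linarith)
  have hceil := Nat.le_ceil (((d : ℝ) - 1) * √(2 * ((d : ℝ) - 1) ^ 2 / (d - 2) + 1 / 4) +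
    ((d : ℝ) - 1) / 2 - 2)
  rw [n₂, if_neg hd₂]
  rify
  linarith

end Bounds

end FreeLocus

end

theorem proposition4p5_general {k : Type*} [Field k] (g : ℕ) :
    (∀ (n : ℕ) (f : FreeAlgebra k (Fin g)), FreeLocus.ncDegree f ≤ 2 * n →
      Irreducible (FreeLocus.polyEval f n).det → FreeLocus.IsPolyAtom f) ∧
    (∀ (d n : ℕ) (A : Fin g → Matrix (Fin d) (Fin d) k), 2 * d ≤ n + 4 →
      Irreducible (FreeLocus.pencilEval A n).det →
      FreeLocus.IsMatrixAtom (FreeLocus.monicPencil A)) :=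
  ⟨fun _ _ => FreeLocus.isPolyAtom_of_irreducible_det,
    fun _ _ _ => FreeLocus.isMatrixAtom_of_irreducible_det⟩

theorem proposition4p5 {k : Type*} [Field k] [IsAlgClosed k] [CharZero k] (g : ℕ) :
    (∀ (δ : ℕ), 1 < δ → ∀ f : FreeAlgebra k (Fin g),
      FreeLocus.ncDegree f = δ →
      FreeAlgebra.lift k (fun _ : Fin g => (0 : k)) f = 1 →
      (∃ n : ℕ, FreeLocus.n₁ δ ≤ n ∧ Irreducible (FreeLocus.polyEval f n).det) →
      FreeLocus.IsPolyAtom f) ∧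
    (∀ (d : ℕ), 1 < d → ∀ A : Fin g → Matrix (Fin d) (Fin d) k,
      (∃ n : ℕ, FreeLocus.n₂ d ≤ n ∧ Irreducible (FreeLocus.pencilEval A n).det) →
      FreeLocus.IsMatrixAtom (FreeLocus.monicPencil A)) := by
  refine ⟨?_, ?_⟩
  · rintro δ - f rfl - ⟨n, hn, hf⟩
    exact (proposition4p5_general g).1 n f (FreeLocus.le_two_mul_of_n₁_le hn) hf
  · rintro d hd A ⟨n, hn, hA⟩
    exact (proposition4p5_general g).2 d n A
      ((FreeLocus.two_mul_le_n₂_add_four hd).trans (Nat.add_le_add_right hn 4)) hA
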